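/- Let $d\ge 1$ and let $g\in L^2(\mathbb{R}^d)$ with $\|g\|_2=1$. For $z=(x,\xi)\in\mathbb{R}^{2d}$ put $V_gf(z)=\int_{\mathbb{R}^d} f(t)\overline{g(t-x)}e^{-2\pi i\xi\cdot t}\,dt$. For a compact set $\Omega\subset\mathbb{R}^{2d}$ let $H_\Omega$ be the localization operator $$H_\Omega f(t)=\int_\Omega V_gf(x,\xi)\,g(t-x)\,e^{2\pi i \xi\cdot t}\,dx\,d\xi$$ on $L^2(\mathbb{R}^d)$. Let $B_R$ be the closed Euclidean ball of radius $R>0$ centred at the origin of $\mathbb{R}^{2d}$. For every $R>0$ the operator $H_{B_R}$ has a diagonalization $H_{B_R}f=\sum_{k\ge1}\lambda_k\langle f,h_k\rangle h_k$, where $\lambda_1\ge\lambda_2\ge\dots>0$ are its non-zero eigenvalues, repeated according to multiplicity, and $(h_k)_{k\ge1}$ is a corresponding orthonormal system of eigenfunctions. For any choice of such a diagonalization let $$\rho_{g,B_R}=\sum_{k=1}^{A}|V_gh_k|^2,\qquad A=\lceil |B_R|\rceil ,$$ be the accumulated spectrogram. Then: 1. For all $R>0$, $\rho_{g,B_R}-1_{B_R}\in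 L^1(\mathbb{R}^{2d})$, and there is a constant $C>0$, depending only on $d$ and $g$, such that $$C R^{2d-1}\le\|\rho_{g,B_R}-1_{B_R}\|_{L^1(\mathbb{R}^{2d})}\qquad\text{for all } R>0.$$ 2. If moreover $\int_{\mathbb{R}^{2d}}|z|\,|V_gg(z)|^2\,dz<\infty$, where $|z|$ is the Euclidean norm, then for every $R_0>0$ there is a constant $C'>0$, depending only on $d$, $g$ and $R_0$, such that $$\|\rho_{g,B_R}-1_{B_R}\|_{L^1(\mathbb{R}^{2d})}\le C'R^{2d-1}\qquad\text{for all } R\ge R_0 .$$ -/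

import Mathlib

open MeasureTheory

open scoped ComplexConjugate

noncomputable section

/-- The space `ℝ^d` with its Euclidean norm. -/
abbrev RSpace (d : ℕ) : Type := EuclideanSpace ℝ (Fin d)

/-- Phase space `ℝ^{2d}`, with points `z = (x, ξ)` and Lebesgue measure. The norm that Mathlib puts
on a product is the maximum norm; the Euclidean one is `phaseNorm` below. -/
abbrev Phase (d : ℕ) : Type := RSpace d × RSpace d

/-- The complex Hilbert space `L²(ℝ^d)`. -/
abbrev L2 (d : ℕ) : Type := Lp ℂ 2 (volume : Measure (RSpace d))

/-- The Euclidean norm of `z = (x, ξ)` in `ℝ^{2d}`. -/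
def phaseNorm {d : ℕ} (z : Phase d) : ℝ := Real.sqrt (‖z.1‖ ^ 2 + ‖z.2‖ ^ 2)

/-- The (compact) Euclidean ball of radius `R` centred at the origin of `ℝ^{2d}`. -/
def phaseBall (d : ℕ) (R : ℝ) : Set (Phase d) := {z | phaseNorm z ≤ R}

/-- The short-time Fourier transform
`V_g f (x, ξ) = ∫ f(t) conj(g(t - x)) e^{-2πi ξ·t} dt`. -/
def stft {d : ℕ} (g f : RSpace d → ℂ) (z : Phase d) : ℂ :=
  ∫ t : RSpace d, f t * conj (g (t - z.1)) *
    Complex.exp (-(2 * (Real.pi : ℂ) * Complex.I * ((inner ℝ z.2 t : ℝ) : ℂ)))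

/-- The spectrogram `|V_g f|²`. -/
def spectrogram {d : ℕ} (g f : RSpace d → ℂ) (z : Phase d) : ℝ := ‖stft g f z‖ ^ 2

/-- The localization operator
`H_Ω f (t) = ∫_Ω V_g f (x, ξ) g(t - x) e^{2πi ξ·t} dx dξ`. -/
def locOp {d : ℕ} (g : RSpace d → ℂ) (Ω : Set (Phase d)) (f : RSpace d → ℂ) (t : RSpace d) : ℂ :=
  ∫ z in Ω, stft g f z * g (t - z.1) *
    Complex.exp (2 * (Real.pi : ℂ) * Complex.I * ((inner ℝ z.2 t : ℝ) : ℂ))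

/-- `lam` lists the non-zero eigenvalues of `H_Ω` in non-increasing order, repeated according to
multiplicity, and `h` is a corresponding orthonormal system of eigenfunctions: `H_Ω` maps `L²(ℝ^d)`
to itself and `H_Ω f = ∑_k lam_k ⟨f, h_k⟩ h_k` for every `f`. The numbering starts at `0`.
(Mathlib's inner product is linear in the second variable. The list is infinite, as it is for
every `Ω` with an interior point and every `g ≠ 0`, in dimension at least one.) -/
structure IsEigensystem {d : ℕ} (g : L2 d) (Ω : Set (Phase d)) (lam : ℕ → ℝ) (h : ℕ → L2 d) :
    Prop where
  antitone : Antitone lam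
  pos : ∀ k, 0 < lam k
  orthonormal : Orthonormal ℂ h
  diagonalizes : ∀ f : L2 d, ∃ F : L2 d, (F : RSpace d → ℂ) =ᵐ[volume] locOp g Ω f ∧
    HasSum (fun k => ((lam k : ℂ) * inner ℂ (h k) f) • h k) F

/-- The accumulated spectrogram `ρ_{g,Ω} = ∑_{k=1}^{A} |V_g h_k|²`, where `A` is the smallest integer
greater than or equal to `|Ω|` and `h` lists the eigenfunctions of `H_Ω`. -/
def accumulatedSpectrogram {d : ℕ} (g : L2 d) (Ω : Set (Phase d)) (h : ℕ → L2 d)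
    (z : Phase d) : ℝ :=
  ∑ k ∈ Finset.range ⌈(volume Ω).toReal⌉₊, spectrogram g (h k) z

/-- The pointwise difference `ρ_{g,Ω} - 1_Ω`. -/
def spectrogramError {d : ℕ} (g : L2 d) (Ω : Set (Phase d)) (h : ℕ → L2 d) (z : Phase d) : ℝ :=
  accumulatedSpectrogram g Ω h z - Ω.indicator (fun _ => (1 : ℝ)) z

/-- The time-frequency concentration condition `∫ |z| |V_g g(z)|² dz < ∞` defining `M^*(ℝ^d)`. -/
def MemMStar {d : ℕ} (g : L2 d) : Prop :=
  Integrable (fun z : Phase d => phaseNorm z * spectrogram g g z)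

end

/-! Since `‖g‖ = 1`, Moyal's identity gives every spectrogram `|V_g h_k|²` total mass 1, and `lam k`
is the part of that mass lying in `Ω`; hence `0 < lam k ≤ 1`. Bessel's inequality for the
time-frequency shifts of `g` gives `0 ≤ ρ ≤ 1`. The absolute value in the `L¹` error can then be
resolved on `Ω` and off it, and the error equals `A + |Ω| - 2 ∑_{k<A} lam k`, a function of the
eigenvalues alone.

The trace of `H` is `|Ω|`. Monotonicity of the eigenvalues together with `|Ω| ≤ A < |Ω| + 1` places
the error between `D` and `2D + 1`, where `D = ∑ lam k (1 - lam k)` is the trace of `H - H²`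
(`Antitone.tsum_mul_one_sub_bounds`). By covariance, `D = ∫ |V_g g(u)|² |Ω \ (Ω + u)| du`
(`IsEigensystem.tsum_mul_one_sub`).

What remains is geometry of balls: `|B_R \ (B_R + u)|` is at most a multiple of `|u| R^(2d-1)`, and
at least `|B_R| |u| / (2R + |u|)`. The upper bound uses the first moment of `|V_g g|²`; the lower
bound needs only a bounded weight, hence no decay of `g`. For small `R` the lower bound comes from
rounding `|B_R|` up to 1. -/

/-! ### Spectral theorem for compact positive operators, by deflation -/

section CompactPositive

variable {H : Type*} [NormedAddCommGroup H] [InnerProductSpace ℂ H]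

open InnerProductSpace Filter Topology

open scoped ComplexOrder in
/-- A nonzero compact positive operator attains its norm as an eigenvalue. -/
theorem exists_eigenvector_norm [CompleteSpace H] {T : H →L[ℂ] H} (hc : IsCompactOperator T)
    (hp : T.IsPositive) (h0 : T ≠ 0) : ∃ v : H, ‖v‖ = 1 ∧ T v = ((‖T‖ : ℝ) : ℂ) • v := by
  have hnt : Nontrivial H := by
    by_contra hn
    rw [not_nontrivial_iff_subsingleton] at hn
    exact h0 (ContinuousLinearMap.ext fun x => Subsingleton.elim _ _)
  obtain ⟨μ, hμ, hμn⟩ := spectrum.exists_nnnorm_eq_spectralRadius T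
  rw [T.spectralRadius_eq_nnnorm hp.isSelfAdjoint] at hμn
  have hμn' : ‖μ‖ = ‖T‖ := by
    have := ENNReal.coe_injective hμn
    exact congrArg NNReal.toReal this
  have hμ0 : μ ≠ 0 := by
    rw [← norm_ne_zero_iff, hμn']
    exact norm_ne_zero_iff.mpr h0
  obtain ⟨v, hv⟩ := ((hc.hasEigenvalue_iff_mem_spectrum hμ0).mpr hμ).exists_hasEigenvector
  have hTv : T v = μ • v := hv.apply_eq_smul
  have hv0 : ‖v‖ ≠ 0 := norm_ne_zero_iff.mpr hv.2
  have hin : inner ℂ v (T v) = μ * ((‖v‖ ^ 2 : ℝ) : ℂ) := by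
    rw [hTv, inner_smul_right, inner_self_eq_norm_sq_to_K]; push_cast; rfl
  have hpos : 0 ≤ inner ℂ v (T v) := hp.inner_nonneg_right v
  have hμpos : 0 ≤ μ := by
    rw [hin] at hpos
    have h2 : (0 : ℂ) ≤ (((‖v‖ ^ 2)⁻¹ : ℝ) : ℂ) := by
      rw [Complex.zero_le_real]; positivity
    have h3 := mul_nonneg hpos h2
    rwa [mul_assoc, ← Complex.ofReal_mul, mul_inv_cancel₀ (pow_ne_zero 2 hv0), Complex.ofReal_one,
      mul_one] at h3
  have hμeq : μ = ((‖T‖ : ℝ) : ℂ) := by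
    rw [← hμn']
    exact (Complex.norm_of_nonneg' hμpos).symm
  refine ⟨((‖v‖⁻¹ : ℝ) : ℂ) • v, ?_, ?_⟩
  · rw [norm_smul, Complex.norm_real, norm_inv, norm_norm, inv_mul_cancel₀ hv0]
  · rw [map_smul, hTv, hμeq, smul_comm]

/-- Removing from `T` its component along an eigenvector `v`. -/
theorem sub_rankOne_apply {T : H →L[ℂ] H} {v : H} {r : ℝ} (hTv : T v = (r : ℂ) • v) (x : H) :
    (T - (r : ℂ) • rankOne ℂ v v) x = T (x - inner ℂ v x • v) := by
  simp only [sub_apply, smul_apply, rankOne_apply, map_sub, map_smul, hTv, smul_comm (r : ℂ)]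

/-- A positive operator minus its component along a unit eigenvector is positive. -/
theorem isPositive_sub_rankOne {T : H →L[ℂ] H} (hp : T.IsPositive) {v : H} (hv : ‖v‖ = 1)
    {r : ℝ} (hTv : T v = (r : ℂ) • v) : (T - (r : ℂ) • rankOne ℂ v v).IsPositive := by
  have hvv : inner ℂ v v = (1 : ℂ) := by
    rw [inner_self_eq_norm_sq_to_K, hv]; simp
  have hkey : ∀ x, inner ℂ ((T - (r : ℂ) • rankOne ℂ v v) x) x
      = inner ℂ (T (x - inner ℂ v x • v)) (x - inner ℂ v x • v) := by
    intro x
    have : inner ℂ (T (x - inner ℂ v x • v)) v = 0 := by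
      rw [hp.inner_left_eq_inner_right, hTv, inner_smul_right, inner_sub_left, inner_smul_left,
        hvv, inner_conj_symm]
      simp
    rw [sub_rankOne_apply hTv, inner_sub_right (T _), inner_smul_right, this, mul_zero, sub_zero]
  rw [ContinuousLinearMap.isPositive_iff_complex] at hp ⊢
  intro x
  rw [hkey]
  exact hp _

/-- Deflation is `T` composed with the orthogonal projection onto the complement of `v`, a
contraction. This makes the successive eigenvalues non-increasing. -/
theorem norm_sub_rankOne_le {T : H →L[ℂ] H} {v : H} (hv : ‖v‖ = 1)
    {r : ℝ} (hTv : T v = (r : ℂ) • v) : ‖T - (r : ℂ) • rankOne ℂ v v‖ ≤ ‖T‖ := by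
  refine ContinuousLinearMap.opNorm_le_bound _ (norm_nonneg _) fun x => ?_
  rw [sub_rankOne_apply hTv]
  refine (T.le_opNorm _).trans (mul_le_mul_of_nonneg_left ?_ (norm_nonneg _))
  have hvv : inner ℂ v v = (1 : ℂ) := by
    rw [inner_self_eq_norm_sq_to_K, hv]; simp
  have h1 : inner ℂ (x - inner ℂ v x • v) (inner ℂ v x • v) = 0 := by
    rw [inner_smul_right, inner_sub_left, inner_smul_left, hvv, inner_conj_symm]
    simp
  have h2 := norm_add_sq_eq_norm_sq_add_norm_sq_of_inner_eq_zero _ _ h1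
  rw [sub_add_cancel] at h2
  nlinarith [norm_nonneg x, norm_nonneg (x - inner ℂ v x • v), norm_nonneg (inner ℂ v x • v)]

open Classical in
/-- A unit eigenvector of `T` for the eigenvalue `‖T‖`, if there is one. -/
noncomputable def topEigenvector (T : H →L[ℂ] H) : H :=
  if h : ∃ v : H, ‖v‖ = 1 ∧ T v = ((‖T‖ : ℝ) : ℂ) • v then h.choose else 0

/-- `T` with its component along `topEigenvector T` removed. -/
noncomputable def deflation (T : H →L[ℂ] H) : H →L[ℂ] H :=
  T - ((‖T‖ : ℝ) : ℂ) • rankOne ℂ (topEigenvector T) (topEigenvector T)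

theorem topEigenvector_spec [CompleteSpace H] {T : H →L[ℂ] H} (hc : IsCompactOperator T)
    (hp : T.IsPositive) (h0 : T ≠ 0) :
    ‖topEigenvector T‖ = 1 ∧ T (topEigenvector T) = ((‖T‖ : ℝ) : ℂ) • topEigenvector T := by
  have h := exists_eigenvector_norm hc hp h0
  rw [topEigenvector, dif_pos h]
  exact h.choose_spec

theorem isCompactOperator_rankOne (v w : H) : IsCompactOperator (rankOne ℂ v w) := by
  have h : IsCompactOperator (innerSL ℂ w) := isCompactOperator_of_locallyCompactSpace_dom _
  exact h.clm_comp (ContinuousLinearMap.toSpanSingleton ℂ v)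

/-- **Spectral theorem** for compact positive operators of infinite rank: the nonzero eigenvalues,
repeated according to multiplicity, form a non-increasing sequence that diagonalizes the operator. -/
theorem exists_eigensystem_of_isPositive [CompleteSpace H] {T : H →L[ℂ] H}
    (hc : IsCompactOperator T) (hp : T.IsPositive)
    (hinf : ∀ (n : ℕ) (v : ℕ → H), ∃ f : H, (∀ k < n, inner ℂ (v k) f = 0) ∧ T f ≠ 0) :
    ∃ (lam : ℕ → ℝ) (h : ℕ → H), Antitone lam ∧ (∀ k, 0 < lam k) ∧ Orthonormal ℂ h ∧
      ∀ f, HasSum (fun k => ((lam k : ℂ) * inner ℂ (h k) f) • h k) (T f) := by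
  set S : ℕ → (H →L[ℂ] H) := fun n => deflation^[n] T with hS
  set h : ℕ → H := fun n => topEigenvector (S n) with hh
  set lam : ℕ → ℝ := fun n => ‖S n‖ with hlam
  have hS0 : S 0 = T := rfl
  have hSs : ∀ n, S (n + 1) = S n - (lam n : ℂ) • rankOne ℂ (h n) (h n) := fun n =>
    Function.iterate_succ_apply' deflation n T
  have hsum : ∀ n f, S n f = T f - ∑ k ∈ Finset.range n, ((lam k : ℂ) * inner ℂ (h k) f) • h k := by
    intro n f
    induction n with
    | zero => simp [hS0]
    | succ n ih =>
      rw [hSs, Finset.sum_range_succ, ← sub_sub, ← ih]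
      simp [mul_smul]
  -- On vectors orthogonal to `h 0, …, h (n-1)` the deflated operator agrees with `T`, so infinite
  -- rank keeps the process from stopping.
  have hSne : ∀ n, S n ≠ 0 := by
    intro n hn
    obtain ⟨f, hf, hTf⟩ := hinf n h
    apply hTf
    have := hsum n f
    rw [hn, Finset.sum_eq_zero (fun k hk => by rw [hf k (Finset.mem_range.mp hk)]; simp)] at this
    simpa using this.symm
  have hcp : ∀ n, IsCompactOperator (S n) ∧ (S n).IsPositive := by
    intro n
    induction n with
    | zero => exact ⟨hc, hp⟩
    | succ n ih =>
      obtain ⟨h1, h2⟩ := topEigenvector_spec ih.1 ih.2 (hSne n)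
      rw [hSs]
      exact ⟨ih.1.sub ((isCompactOperator_rankOne (h n) (h n)).smul (lam n : ℂ)),
        isPositive_sub_rankOne ih.2 h1 h2⟩
  have hspec := fun n => topEigenvector_spec (hcp n).1 (hcp n).2 (hSne n)
  have hpos : ∀ n, 0 < lam n := fun n => norm_pos_iff.mpr (hSne n)
  have hanti : Antitone lam := antitone_nat_of_succ_le fun n => by
    simp only [hlam]
    rw [hSs]
    exact norm_sub_rankOne_le (hspec n).1 (hspec n).2
  have hker : ∀ n j, j < n → S n (h j) = 0 := by
    intro n
    induction n with
    | zero => intro j hj; omega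
    | succ n ih =>
      intro j hj
      have hvv : inner ℂ (h n) (h n) = (1 : ℂ) := by
        rw [inner_self_eq_norm_sq_to_K, (hspec n).1]; simp
      rw [hSs, sub_rankOne_apply (hspec n).2]
      rcases Nat.lt_succ_iff_lt_or_eq.mp hj with hj | rfl
      · have : (lam n : ℂ) * inner ℂ (h n) (h j) = 0 := by
          have h1 := (hcp n).2.inner_left_eq_inner_right (h n) (h j)
          rw [ih j hj, (hspec n).2, inner_smul_left] at h1
          simpa [hlam] using h1
        have h0 : inner ℂ (h n) (h j) = 0 :=
          (mul_eq_zero.mp this).resolve_left (by exact_mod_cast (hpos n).ne')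
        rw [h0, zero_smul, sub_zero, ih j hj]
      · rw [hvv, one_smul, sub_self, map_zero]
  have horth' : ∀ i j, j < i → inner ℂ (h i) (h j) = 0 := by
    intro i j hij
    have h1 := (hcp i).2.inner_left_eq_inner_right (h i) (h j)
    rw [hker i j hij, (hspec i).2, inner_smul_left] at h1
    have : (lam i : ℂ) * inner ℂ (h i) (h j) = 0 := by simpa [hlam] using h1
    exact (mul_eq_zero.mp this).resolve_left (by exact_mod_cast (hpos i).ne')
  have horth : Orthonormal ℂ h := by
    refine ⟨fun n => (hspec n).1, fun i j hij => ?_⟩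
    rcases lt_or_gt_of_ne hij with hlt | hlt
    · exact inner_eq_zero_symm.mp (horth' j i hlt)
    · exact horth' i j hlt
  have hTh : ∀ n, T (h n) = (lam n : ℂ) • h n := by
    intro n
    have h1 := hsum n (h n)
    rw [Finset.sum_eq_zero (fun k hk => by
      rw [inner_eq_zero_symm.mp (horth' n k (Finset.mem_range.mp hk))]; simp), sub_zero] at h1
    rw [← h1]
    exact (hspec n).2
  -- If the limit `c` were positive, the vectors `T (h n) = lam n • h n` would be orthogonal with
  -- norms at least `c`, hence pairwise at distance at least `c`; compactness of `T` forbids this.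
  have hlim : Tendsto lam atTop (𝓝 0) := by
    have hbdd : BddBelow (Set.range lam) := ⟨0, by rintro _ ⟨n, rfl⟩; exact (hpos n).le⟩
    have hinfi := tendsto_atTop_ciInf hanti hbdd
    set c := ⨅ n, lam n with hcdef
    have hcle : ∀ n, c ≤ lam n := fun n => ciInf_le hbdd n
    have hc0 : 0 ≤ c := le_ciInf fun n => (hpos n).le
    rcases hc0.eq_or_lt with hc0 | hc0
    · rw [hc0]; exact hinfi
    exfalso
    obtain ⟨K, hK, hK'⟩ := hc.image_closedBall_subset_compact 1
    obtain ⟨y, -, φ, hφ, hφy⟩ := hK.tendsto_subseq (x := fun n => T (h n))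
      (fun n => hK' ⟨h n, by simp [(hspec n).1, hh], rfl⟩)
    have hcau := hφy.cauchySeq
    rw [Metric.cauchySeq_iff'] at hcau
    obtain ⟨N, hN⟩ := hcau c hc0
    have h1 := hN (N + 1) (Nat.le_succ N)
    simp only [Function.comp_apply, hTh, dist_eq_norm] at h1
    have hlt : φ N < φ (N + 1) := hφ (Nat.lt_succ_self N)
    have h2 := norm_sub_sq (𝕜 := ℂ) ((lam (φ (N + 1)) : ℂ) • h (φ (N + 1)))
      ((lam (φ N) : ℂ) • h (φ N))
    rw [inner_smul_left, inner_smul_right, horth' _ _ hlt, mul_zero, mul_zero, map_zero, mul_zero,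
      sub_zero] at h2
    have h3 : ‖(lam (φ N) : ℂ) • h (φ N)‖ = lam (φ N) := by
      rw [norm_smul, (hspec _).1, mul_one, Complex.norm_real, Real.norm_of_nonneg (hpos _).le]
    rw [h3] at h2
    nlinarith [hcle (φ N), norm_nonneg ((lam (φ (N + 1)) : ℂ) • h (φ (N + 1)) -
      (lam (φ N) : ℂ) • h (φ N)), norm_nonneg ((lam (φ (N + 1)) : ℂ) • h (φ (N + 1)))]
  refine ⟨lam, h, hanti, hpos, horth, fun f => ?_⟩
  have hsummable : Summable (fun k => ((lam k : ℂ) * inner ℂ (h k) f) • h k) := by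
    have hfam := horth.orthogonalFamily
    have := (hfam.summable_iff_norm_sq_summable
      (fun k => (lam k : ℂ) * inner ℂ (h k) f)).mpr ?_
    · simpa using this
    · refine Summable.of_nonneg_of_le (fun k => by positivity) (fun k => ?_)
        ((horth.inner_products_summable f).mul_left (lam 0 ^ 2))
      rw [norm_mul, mul_pow, Complex.norm_real, Real.norm_of_nonneg (hpos k).le]
      have := (hpos k).le
      gcongr
      exact hanti (Nat.zero_le k)
  rw [hsummable.hasSum_iff_tendsto_nat, tendsto_iff_norm_sub_tendsto_zero]
  -- The remainder after `n` terms is `S n f`, and `‖S n‖ = lam n`.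
  refine squeeze_zero (fun n => norm_nonneg _) (g := fun n => lam n * ‖f‖) (fun n => ?_) ?_
  · rw [norm_sub_rev, ← hsum]
    exact (S n).le_opNorm f
  · simpa using hlim.mul_const ‖f‖

end CompactPositive

/-! ### Time-frequency shifts and covariance of the spectrogram -/

section TimeFrequencyShift

open Filter Topology

variable {d : ℕ}

/-- The character `e^{2πi ξ·t}`. -/
noncomputable def tfChar (ξ t : RSpace d) : ℂ :=
  Complex.exp (2 * (Real.pi : ℂ) * Complex.I * ((inner ℝ ξ t : ℝ) : ℂ))

theorem norm_tfChar (ξ t : RSpace d) : ‖tfChar ξ t‖ = 1 := by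
  rw [tfChar, Complex.norm_exp]
  simp

theorem continuous_tfChar : Continuous fun p : RSpace d × RSpace d => tfChar p.1 p.2 := by
  unfold tfChar
  fun_prop

theorem conj_tfChar (ξ t : RSpace d) :
    conj (tfChar ξ t)
      = Complex.exp (-(2 * (Real.pi : ℂ) * Complex.I * ((inner ℝ ξ t : ℝ) : ℂ))) := by
  rw [tfChar, ← Complex.exp_conj]
  simp [Complex.conj_ofNat]

theorem tfChar_add_right (ξ s t : RSpace d) : tfChar ξ (s + t) = tfChar ξ s * tfChar ξ t := by
  simp only [tfChar, ← Complex.exp_add, inner_add_right]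
  push_cast
  ring_nf

theorem tfChar_sub_left (ξ η t : RSpace d) :
    tfChar (ξ - η) t = tfChar ξ t * conj (tfChar η t) := by
  rw [conj_tfChar, tfChar, tfChar, ← Complex.exp_add, inner_sub_left]
  push_cast
  ring_nf

theorem L2.norm_sq_eq_integral (f : L2 d) : ‖f‖ ^ 2 = ∫ t, ‖f t‖ ^ 2 := by
  have h := L2.inner_def (𝕜 := ℂ) f f
  rw [inner_self_eq_norm_sq_to_K] at h
  simp only [inner_self_eq_norm_sq_to_K] at h
  have h2 : ((‖f‖ ^ 2 : ℝ) : ℂ) = ((∫ t, ‖f t‖ ^ 2 : ℝ) : ℂ) := by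
    rw [← integral_complex_ofReal]
    push_cast
    exact h
  exact_mod_cast h2

theorem L2.integrable_norm_sq (f : L2 d) : Integrable fun t => ‖f t‖ ^ 2 :=
  (memLp_two_iff_integrable_sq_norm (Lp.aestronglyMeasurable f)).mp (Lp.memLp f)

theorem memLp_tfChar_mul (ξ : RSpace d) (f : L2 d) : MemLp (fun t => tfChar ξ t * f t) 2 := by
  refine (Lp.memLp f).of_le_mul (c := 1) ?_ (ae_of_all _ fun t => ?_)
  · exact (continuous_tfChar.comp (by fun_prop : Continuous fun t : RSpace d => (ξ, t)))
      |>.aestronglyMeasurable.mul (Lp.aestronglyMeasurable f)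
  · rw [norm_mul, norm_tfChar]

/-- The modulation `f ↦ e^{2πi ξ·t} f(t)`. -/
noncomputable def modulation (ξ : RSpace d) (f : L2 d) : L2 d := (memLp_tfChar_mul ξ f).toLp

theorem coeFn_modulation (ξ : RSpace d) (f : L2 d) :
    modulation ξ f =ᵐ[volume] fun t => tfChar ξ t * f t :=
  MemLp.coeFn_toLp _

theorem isometry_modulation (ξ : RSpace d) : Isometry (modulation ξ) := by
  refine Isometry.of_dist_eq fun f g => ?_
  rw [dist_eq_norm, dist_eq_norm, Lp.norm_def, Lp.norm_def]
  congr 1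
  refine eLpNorm_congr_norm_ae ?_
  filter_upwards [coeFn_modulation ξ f, coeFn_modulation ξ g, Lp.coeFn_sub f g,
    Lp.coeFn_sub (modulation ξ f) (modulation ξ g)] with t h1 h2 h3 h4
  rw [h3, h4, Pi.sub_apply, Pi.sub_apply, h1, h2, ← mul_sub, norm_mul, norm_tfChar, one_mul]

/-- Dominated convergence with majorant `4 |f|²`, since two characters differ by at most 2. -/
theorem continuous_modulation_left (f : L2 d) : Continuous fun ξ => modulation ξ f := by
  rw [continuous_iff_continuousAt]
  intro ξ₀
  rw [ContinuousAt, tendsto_iff_norm_sub_tendsto_zero]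
  have hsq : ∀ ξ, ‖modulation ξ f - modulation ξ₀ f‖
      = Real.sqrt (∫ t, ‖(tfChar ξ t - tfChar ξ₀ t) * f t‖ ^ 2) := by
    intro ξ
    rw [← Real.sqrt_sq (norm_nonneg (modulation ξ f - modulation ξ₀ f)), L2.norm_sq_eq_integral]
    congr 1
    refine integral_congr_ae ?_
    filter_upwards [coeFn_modulation ξ f, coeFn_modulation ξ₀ f,
      Lp.coeFn_sub (modulation ξ f) (modulation ξ₀ f)] with t h1 h2 h3
    rw [h3, Pi.sub_apply, h1, h2, sub_mul]
  simp_rw [hsq]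
  have key : Tendsto (fun ξ => ∫ t, ‖(tfChar ξ t - tfChar ξ₀ t) * f t‖ ^ 2) (𝓝 ξ₀)
      (𝓝 (∫ _ : RSpace d, (0 : ℝ))) := by
    refine tendsto_integral_filter_of_dominated_convergence (fun t => 4 * ‖f t‖ ^ 2)
      (Eventually.of_forall fun ξ => ?_) (Eventually.of_forall fun ξ => ae_of_all _ fun t => ?_)
      ((L2.integrable_norm_sq f).const_mul 4) (ae_of_all _ fun t => ?_)
    · have hc : ∀ ξ : RSpace d, Continuous fun t => tfChar ξ t := fun ξ =>
        continuous_tfChar.comp (by fun_prop : Continuous fun t : RSpace d => (ξ, t))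
      exact ((((hc ξ).sub (hc ξ₀)).aestronglyMeasurable.mul
        (Lp.aestronglyMeasurable f)).norm).pow 2
    · rw [Real.norm_of_nonneg (by positivity), norm_mul, mul_pow]
      have : ‖tfChar ξ t - tfChar ξ₀ t‖ ≤ 2 := by
        refine (norm_sub_le _ _).trans ?_
        rw [norm_tfChar, norm_tfChar]; norm_num
      have h4 : ‖tfChar ξ t - tfChar ξ₀ t‖ ^ 2 ≤ 4 := by
        nlinarith [norm_nonneg (tfChar ξ t - tfChar ξ₀ t)]
      gcongr
    · have hc : Continuous fun ξ : RSpace d => ‖(tfChar ξ t - tfChar ξ₀ t) * f t‖ ^ 2 := by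
        have : Continuous fun ξ : RSpace d => tfChar ξ t :=
          continuous_tfChar.comp (by fun_prop : Continuous fun ξ : RSpace d => (ξ, t))
        fun_prop
      simpa using hc.tendsto ξ₀
  have h2 := (Real.continuous_sqrt.tendsto _).comp key
  simpa [Function.comp_def] using h2

theorem measurePreserving_sub_const (x : RSpace d) :
    MeasurePreserving (fun t : RSpace d => t - x) volume volume :=
  measurePreserving_sub_right volume x

/-- The translation `f ↦ f(· - x)`. -/
noncomputable def translation (x : RSpace d) (f : L2 d) : L2 d :=
  Lp.compMeasurePreserving (fun t => t - x) (measurePreserving_sub_const x) f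

theorem coeFn_translation (x : RSpace d) (f : L2 d) :
    translation x f =ᵐ[volume] fun t => f (t - x) :=
  Lp.coeFn_compMeasurePreserving f (measurePreserving_sub_const x)

theorem norm_translation (x : RSpace d) (f : L2 d) : ‖translation x f‖ = ‖f‖ :=
  Lp.norm_compMeasurePreserving f (measurePreserving_sub_const x)

theorem continuous_translation_left (f : L2 d) : Continuous fun x => translation x f := by
  let F : C(RSpace d, C(RSpace d, RSpace d)) :=
    (ContinuousMap.mk (fun p : RSpace d × RSpace d => p.2 - p.1) (by fun_prop)).curry
  have h := Lp.compMeasurePreserving_continuous (p := 2) (volume : Measure (RSpace d))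
    (volume : Measure (RSpace d)) ℂ (by norm_num)
  have h2 : Continuous fun x : RSpace d => ((f, ⟨F x, measurePreserving_sub_const x⟩) :
      L2 d × {k : C(RSpace d, RSpace d) // MeasurePreserving k volume volume}) := by
    refine continuous_const.prodMk (Continuous.subtype_mk F.continuous _)
  exact h.comp h2

/-- The time-frequency shift `t ↦ e^{2πi ξ·t} g(t - x)` of `g` by `z = (x, ξ)`. -/
noncomputable def tfShift (g : L2 d) (z : Phase d) : L2 d := modulation z.2 (translation z.1 g)

theorem coeFn_tfShift (g : L2 d) (z : Phase d) :
    tfShift g z =ᵐ[volume] fun t => tfChar z.2 t * g (t - z.1) := by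
  filter_upwards [coeFn_modulation z.2 (translation z.1 g), coeFn_translation z.1 g] with t h1 h2
  rw [tfShift, h1, h2]

theorem norm_tfShift (g : L2 d) (z : Phase d) : ‖tfShift g z‖ = ‖g‖ := by
  have h0 : modulation z.2 (0 : L2 d) = 0 := by
    refine Lp.ext ?_
    filter_upwards [coeFn_modulation z.2 (0 : L2 d), Lp.coeFn_zero ℂ 2 (volume : Measure (RSpace d))]
      with t h1 h2
    rw [h1, h2]; simp
  have h := (isometry_modulation z.2).dist_eq (translation z.1 g) 0
  rw [h0, dist_zero_right, dist_zero_right, norm_translation] at h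
  exact h

theorem continuous_tfShift (g : L2 d) : Continuous (tfShift g) := by
  rw [continuous_iff_continuousAt]
  intro z₀
  rw [ContinuousAt, tendsto_iff_dist_tendsto_zero]
  -- Modulations are isometries, so moving the translation first and the modulation second reduces
  -- joint continuity to continuity in each variable.
  refine squeeze_zero (fun z => dist_nonneg) (g := fun z : Phase d =>
    dist (translation z.1 g) (translation z₀.1 g)
      + dist (modulation z.2 (translation z₀.1 g)) (modulation z₀.2 (translation z₀.1 g)))
    (fun z => ?_) ?_
  · refine (dist_triangle _ (modulation z.2 (translation z₀.1 g)) _).trans (le_of_eq ?_)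
    rw [tfShift, (isometry_modulation z.2).dist_eq]
    rfl
  · have h1 := continuous_translation_left g
    have h2 := continuous_modulation_left (translation z₀.1 g)
    have h3 : Continuous fun z : Phase d => dist (translation z.1 g) (translation z₀.1 g)
      + dist (modulation z.2 (translation z₀.1 g)) (modulation z₀.2 (translation z₀.1 g)) := by
      fun_prop
    simpa using h3.tendsto z₀

/-- The bridge to Hilbert space geometry: continuity, boundedness and Bessel's inequality for the
transform all pass through it. -/
theorem stft_eq_inner (g f : L2 d) (z : Phase d) : stft g f z = inner ℂ (tfShift g z) f := by
  rw [L2.inner_def, stft]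
  refine integral_congr_ae ?_
  filter_upwards [coeFn_tfShift g z] with t ht
  rw [ht, RCLike.inner_apply, map_mul, conj_tfChar]
  ring

theorem spectrogram_eq (g f : L2 d) (z : Phase d) :
    spectrogram g f z = ‖inner ℂ (tfShift g z) f‖ ^ 2 := by
  rw [spectrogram, stft_eq_inner]

theorem continuous_spectrogram (g f : L2 d) : Continuous (spectrogram g f) := by
  have := continuous_tfShift g
  simp_rw [funext (spectrogram_eq g f)]
  fun_prop

/-- Covariance of the spectrogram under time-frequency shifts. -/
theorem spectrogram_tfShift (g : L2 d) (w z : Phase d) :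
    spectrogram g (tfShift g z) w = spectrogram g g (w - z) := by
  have h : stft g (tfShift g z) w
      = conj (tfChar (w.2 - z.2) z.1) * stft g g (w - z) := by
    rw [stft, stft, ← integral_const_mul, ← integral_sub_right_eq_self (fun t =>
      conj (tfChar (w.2 - z.2) z.1) * (g t * conj (g (t - (w - z).1)) *
        Complex.exp (-(2 * (Real.pi : ℂ) * Complex.I * ((inner ℝ (w - z).2 t : ℝ) : ℂ))))) z.1]
    refine integral_congr_ae ?_
    filter_upwards [coeFn_tfShift g z] with t ht
    have hchar : tfChar z.2 t * conj (tfChar w.2 t)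
        = conj (tfChar (w.2 - z.2) z.1) * conj (tfChar (w.2 - z.2) (t - z.1)) := by
      rw [← map_mul, ← tfChar_add_right, add_sub_cancel, tfChar_sub_left, map_mul,
        Complex.conj_conj, mul_comm]
    rw [ht, ← conj_tfChar, Prod.snd_sub, Prod.fst_sub, ← conj_tfChar,
      show t - z.1 - (w.1 - z.1) = t - w.1 by abel]
    linear_combination (g (t - z.1) * conj (g (t - w.1))) * hchar
  rw [spectrogram, spectrogram, h, norm_mul, RCLike.norm_conj, norm_tfChar, one_mul]

end TimeFrequencyShift

/-! ### Plancherel's theorem for the Fourier integral -/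

section Plancherel

open FourierTransform

variable {V : Type*} [NormedAddCommGroup V] [InnerProductSpace ℝ V] [FiniteDimensional ℝ V]
  [MeasurableSpace V] [BorelSpace V]

/-- On `L¹ ∩ L²` the `L²` Fourier transform is given by the Fourier integral. -/
theorem fourier_toLp_ae_eq {f : V → ℂ} (h1 : Integrable f) (h2 : MemLp f 2) :
    (𝓕 (h2.toLp f) : Lp ℂ 2 (volume : Measure V)) =ᵐ[volume] 𝓕 f := by
  have hcont : Continuous (𝓕 f) :=
    VectorFourier.fourierIntegral_continuous Real.continuous_fourierChar (L := innerₗ V)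
      continuous_inner h1
  -- Both sides are tested against smooth compactly supported `φ`. Duality of tempered distributions
  -- on the `L²` side and the multiplication formula on the integral side both move the transform
  -- onto `φ`.
  refine ae_eq_of_integral_contDiff_smul_eq
    ((Lp.memLp _).locallyIntegrable (by norm_num)) hcont.locallyIntegrable fun φ hφ hc => ?_
  have hφc : ContDiff ℝ (⊤ : ℕ∞) fun x => (φ x : ℂ) := Complex.ofRealCLM.contDiff.comp hφ
  have hcc : HasCompactSupport fun x => (φ x : ℂ) := hc.comp_left Complex.ofReal_zero
  let Φ : SchwartzMap V ℂ := hcc.toSchwartzMap hφc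
  have hΦ : ∀ x, Φ x = (φ x : ℂ) := fun x => rfl
  have hA := congrArg (fun T => T Φ) (Lp.fourier_toTemperedDistribution_eq (h2.toLp f))
  simp only [TemperedDistribution.fourier_apply, Lp.toTemperedDistribution_apply] at hA
  have hB := VectorFourier.integral_fourierIntegral_smul_eq_flip (L := innerₗ V)
    Real.continuous_fourierChar continuous_inner (Φ.integrable (μ := volume)) h1
  rw [flip_innerₗ] at hB
  calc ∫ x, φ x • (𝓕 (h2.toLp f) : Lp ℂ 2 (volume : Measure V)) x
      = ∫ x, Φ x • (𝓕 (h2.toLp f) : Lp ℂ 2 (volume : Measure V)) x := by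
        simp [hΦ]
    _ = ∫ x, (𝓕 Φ) x • (h2.toLp f) x := hA.symm
    _ = ∫ x, (𝓕 Φ) x • f x := by
        refine integral_congr_ae ?_
        filter_upwards [h2.coeFn_toLp] with x hx
        rw [hx]
    _ = ∫ x, Φ x • 𝓕 f x := by
        rw [SchwartzMap.fourier_coe]
        exact hB
    _ = ∫ x, φ x • 𝓕 f x := by
        simp [hΦ]

theorem lintegral_enorm_sq_eq (f : V → ℂ) :
    ∫⁻ t, ‖f t‖ₑ ^ 2 = eLpNorm f 2 volume ^ 2 := by
  have := eLpNorm_nnreal_pow_eq_lintegral (f := f) (μ := volume) (p := 2) (by norm_num)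
  simpa using this.symm

/-- **Plancherel's theorem** for the Fourier integral on `L¹ ∩ L²`. -/
theorem lintegral_fourier_sq {f : V → ℂ} (h1 : Integrable f) (h2 : MemLp f 2) :
    ∫⁻ ξ, ‖𝓕 f ξ‖ₑ ^ 2 = ∫⁻ t, ‖f t‖ₑ ^ 2 := by
  rw [lintegral_enorm_sq_eq, lintegral_enorm_sq_eq, ← eLpNorm_congr_ae (fourier_toLp_ae_eq h1 h2)]
  have h3 := Lp.norm_fourier_eq (h2.toLp f)
  rw [Lp.norm_def, Lp.norm_def, ENNReal.toReal_eq_toReal_iff' (Lp.eLpNorm_ne_top _)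
    (Lp.eLpNorm_ne_top _)] at h3
  rw [h3, eLpNorm_congr_ae h2.coeFn_toLp]

end Plancherel

/-! ### Moyal's identity -/

section Moyal

open FourierTransform

variable {d : ℕ}

theorem stft_eq_fourier (g f : RSpace d → ℂ) (x ξ : RSpace d) :
    stft g f (x, ξ) = 𝓕 (fun t => f t * conj (g (t - x))) ξ := by
  rw [Real.fourier_eq', stft]
  refine integral_congr_ae (ae_of_all _ fun t => ?_)
  simp only [smul_eq_mul]
  rw [mul_comm, real_inner_comm]
  congr 2
  push_cast
  ring

theorem L2.lintegral_enorm_sq (f : L2 d) : ∫⁻ t, ‖f t‖ₑ ^ 2 = ENNReal.ofReal (‖f‖ ^ 2) := by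
  rw [L2.norm_sq_eq_integral, ofReal_integral_eq_lintegral_ofReal (L2.integrable_norm_sq f)
    (ae_of_all _ fun t => by positivity)]
  refine lintegral_congr fun t => ?_
  rw [ENNReal.ofReal_pow (norm_nonneg _), ofReal_norm]

theorem memLp_shift (g : L2 d) (x : RSpace d) : MemLp (fun t => g (t - x)) 2 :=
  (Lp.memLp g).comp_measurePreserving (measurePreserving_sub_const x)

theorem integrable_mul_conj_shift (f g : L2 d) (x : RSpace d) :
    Integrable fun t => f t * conj (g (t - x)) :=
  (Lp.memLp f).integrable_mul (memLp_shift g x).star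

/-- **Moyal's identity**: the short-time Fourier transform is an isometry up to `‖g‖`. -/
theorem lintegral_stft_sq (g f : L2 d) :
    ∫⁻ z : Phase d, ‖stft g f z‖ₑ ^ 2 = ENNReal.ofReal (‖f‖ ^ 2 * ‖g‖ ^ 2) := by
  have hcont : Continuous (stft g f) := by
    rw [funext (stft_eq_inner g f)]
    exact (continuous_tfShift g).inner continuous_const
  have hprod : ∀ x t, ‖f t * conj (g (t - x))‖ₑ ^ 2 = ‖f t‖ₑ ^ 2 * ‖g (t - x)‖ₑ ^ 2 := by
    intro x t
    rw [enorm_mul, mul_pow, RCLike.enorm_conj]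
  have hfm : Measurable fun t => ‖f t‖ₑ ^ 2 :=
    (Lp.stronglyMeasurable f).measurable.enorm.pow_const 2
  have hgm : Measurable fun t => ‖g t‖ₑ ^ 2 :=
    (Lp.stronglyMeasurable g).measurable.enorm.pow_const 2
  have hmeas : Measurable fun p : RSpace d × RSpace d => ‖f p.2 * conj (g (p.2 - p.1))‖ₑ ^ 2 := by
    simp_rw [hprod]
    exact (hfm.comp measurable_snd).mul (hgm.comp (measurable_snd.sub measurable_fst))
  have htotal : ∫⁻ x : RSpace d, ∫⁻ t, ‖f t * conj (g (t - x))‖ₑ ^ 2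
      = ENNReal.ofReal (‖f‖ ^ 2 * ‖g‖ ^ 2) := by
    rw [lintegral_lintegral_swap hmeas.aemeasurable]
    simp_rw [hprod]
    have : ∀ t : RSpace d, ∫⁻ x, ‖f t‖ₑ ^ 2 * ‖g (t - x)‖ₑ ^ 2
        = ‖f t‖ₑ ^ 2 * ENNReal.ofReal (‖g‖ ^ 2) := by
      intro t
      rw [lintegral_const_mul (f := fun x => ‖g (t - x)‖ₑ ^ 2) _
          (hgm.comp (measurable_const.sub measurable_id)),
        lintegral_sub_left_eq_self (fun y => ‖g y‖ₑ ^ 2), L2.lintegral_enorm_sq]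
    simp_rw [this]
    rw [lintegral_mul_const _ hfm, L2.lintegral_enorm_sq, ← ENNReal.ofReal_mul (by positivity)]
  rw [Measure.volume_eq_prod, lintegral_prod _ (hcont.enorm.measurable.pow_const 2).aemeasurable,
    ← htotal]
  -- The slice in `t` is integrable for every `x`, but square integrable only for almost every `x`,
  -- by Tonelli; that suffices for applying Plancherel slicewise.
  have hfin : ∀ᵐ x : RSpace d, ∫⁻ t, ‖f t * conj (g (t - x))‖ₑ ^ 2 < ⊤ :=
    ae_lt_top hmeas.lintegral_prod_right' (by rw [htotal]; exact ENNReal.ofReal_ne_top)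
  refine lintegral_congr_ae ?_
  filter_upwards [hfin] with x hx
  have hi := integrable_mul_conj_shift f g x
  have h2 : MemLp (fun t => f t * conj (g (t - x))) 2 := by
    refine ⟨hi.aestronglyMeasurable, ?_⟩
    rw [lintegral_enorm_sq_eq] at hx
    by_contra h
    rw [not_lt, top_le_iff] at h
    rw [h] at hx
    exact absurd hx (by simp)
  simp_rw [stft_eq_fourier]
  exact lintegral_fourier_sq hi h2

theorem lintegral_spectrogram (g f : L2 d) :
    ∫⁻ z : Phase d, ENNReal.ofReal (spectrogram g f z) = ENNReal.ofReal (‖f‖ ^ 2 * ‖g‖ ^ 2) := by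
  rw [← lintegral_stft_sq]
  refine lintegral_congr fun z => ?_
  rw [spectrogram, ENNReal.ofReal_pow (norm_nonneg _), ofReal_norm]

theorem spectrogram_nonneg (g f : RSpace d → ℂ) (z : Phase d) : 0 ≤ spectrogram g f z := by
  rw [spectrogram]; positivity

theorem integrable_spectrogram (g f : L2 d) : Integrable (spectrogram g f) := by
  refine ⟨(continuous_spectrogram g f).aestronglyMeasurable, ?_⟩
  rw [hasFiniteIntegral_iff_ofReal (ae_of_all _ (spectrogram_nonneg g f)), lintegral_spectrogram]
  exact ENNReal.ofReal_lt_top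

theorem integral_spectrogram (g f : L2 d) : ∫ z, spectrogram g f z = ‖f‖ ^ 2 * ‖g‖ ^ 2 := by
  rw [integral_eq_lintegral_of_nonneg_ae (ae_of_all _ (spectrogram_nonneg g f))
    (continuous_spectrogram g f).aestronglyMeasurable, lintegral_spectrogram,
    ENNReal.toReal_ofReal (by positivity)]

end Moyal

/-! ### The localization operator as a compact positive operator -/

section LocalizationOperator

open Filter Topology InnerProductSpace

variable {d : ℕ}

theorem continuous_rankOne_tfShift (g : L2 d) :
    Continuous fun z => rankOne ℂ (tfShift g z) (tfShift g z) :=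
  (ContinuousLinearMap.smulRightL ℂ (L2 d) (L2 d)).continuous₂.comp
    (((innerSL ℂ).continuous.comp (continuous_tfShift g)).prodMk (continuous_tfShift g))

/-- The localization operator as a bounded operator on `L²`. -/
noncomputable def locOpCLM (g : L2 d) (Ω : Set (Phase d)) : L2 d →L[ℂ] L2 d :=
  ∫ z in Ω, rankOne ℂ (tfShift g z) (tfShift g z)

theorem locOpCLM_apply (g : L2 d) {Ω : Set (Phase d)} (hΩ : IsCompact Ω) (f : L2 d) :
    locOpCLM g Ω f = ∫ z in Ω, inner ℂ (tfShift g z) f • tfShift g z := by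
  rw [locOpCLM, ContinuousLinearMap.integral_apply
    ((continuous_rankOne_tfShift g).continuousOn.integrableOn_compact hΩ)]
  simp

theorem inner_locOpCLM (g : L2 d) {Ω : Set (Phase d)} (hΩ : IsCompact Ω) (φ f : L2 d) :
    inner ℂ φ (locOpCLM g Ω f) = ∫ z in Ω, stft g f z * inner ℂ φ (tfShift g z) := by
  have hc := continuous_tfShift g
  have hi : IntegrableOn (fun z => inner ℂ (tfShift g z) f • tfShift g z) Ω :=
    (by fun_prop : Continuous fun z => inner ℂ (tfShift g z) f • tfShift g z)
      |>.continuousOn.integrableOn_compact hΩ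
  rw [locOpCLM_apply g hΩ, ← innerSL_apply_apply, ← ContinuousLinearMap.integral_comp_comm _ hi]
  refine integral_congr_ae (ae_of_all _ fun z => ?_)
  simp only [innerSL_apply_apply, inner_smul_right, stft_eq_inner]

/-- The quadratic form measures spectrogram mass in `Ω`; positivity, infinite rank and the
eigenvalue formula rest on it. -/
theorem inner_locOpCLM_self (g : L2 d) {Ω : Set (Phase d)} (hΩ : IsCompact Ω) (f : L2 d) :
    inner ℂ f (locOpCLM g Ω f) = ((∫ z in Ω, spectrogram g f z : ℝ) : ℂ) := by
  rw [inner_locOpCLM g hΩ, ← integral_complex_ofReal]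
  refine integral_congr_ae (ae_of_all _ fun z => ?_)
  simp only [spectrogram_eq, stft_eq_inner]
  rw [← inner_conj_symm f, RCLike.mul_conj]
  push_cast
  rfl

theorem isPositive_locOpCLM (g : L2 d) {Ω : Set (Phase d)} (hΩ : IsCompact Ω) :
    (locOpCLM g Ω).IsPositive := by
  rw [ContinuousLinearMap.isPositive_iff_complex]
  intro f
  have h : inner ℂ (locOpCLM g Ω f) f = ((∫ z in Ω, spectrogram g f z : ℝ) : ℂ) := by
    rw [← inner_conj_symm, inner_locOpCLM_self g hΩ, Complex.conj_ofReal]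
  rw [h]
  refine ⟨by simp, ?_⟩
  simpa using integral_nonneg fun z => spectrogram_nonneg g f z

/-- Compact operators form a closed convex set, which contains the average of a continuous family of
rank-one operators. The average requires positive measure, so null sets are split off. -/
theorem isCompactOperator_locOpCLM (g : L2 d) {Ω : Set (Phase d)} (hΩ : IsCompact Ω) :
    IsCompactOperator (locOpCLM g Ω) := by
  rcases eq_or_ne (volume Ω) 0 with h0 | h0
  · rw [locOpCLM, setIntegral_measure_zero _ h0]
    exact isCompactOperator_zero
  have hconv : Convex ℝ {T : L2 d →L[ℂ] L2 d | IsCompactOperator T} := by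
    intro S hS T hT a b _ _ _
    exact (hS.smul a).add (hT.smul b)
  have h := hconv.set_average_mem isClosed_setOfPred_isCompactOperator h0 hΩ.measure_ne_top
    (ae_of_all _ fun z => isCompactOperator_rankOne (tfShift g z) (tfShift g z))
    ((continuous_rankOne_tfShift g).continuousOn.integrableOn_compact hΩ)
  rw [locOpCLM, ← measure_smul_setAverage _ hΩ.measure_ne_top]
  exact IsCompactOperator.smul (S := ℝ) h (volume.real Ω)

theorem norm_stft_le (g f : L2 d) (z : Phase d) : ‖stft g f z‖ ≤ ‖g‖ * ‖f‖ := by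
  rw [stft_eq_inner, ← norm_tfShift g z]
  exact norm_inner_le_norm _ _

theorem continuous_stft (g f : L2 d) : Continuous (stft g f) := by
  rw [funext (stft_eq_inner g f)]
  exact (continuous_tfShift g).inner continuous_const

/-- Joint integrability of the kernel of the localization operator. -/
theorem integrable_locOp_kernel (g f : L2 d) {Ω : Set (Phase d)} (hΩ : IsCompact Ω)
    {s : Set (RSpace d)} (hs : volume s < ⊤) :
    Integrable (fun p : Phase d × RSpace d => stft g f p.1 * g (p.2 - p.1.1) * tfChar p.1.2 p.2)
      ((volume.restrict Ω).prod (volume.restrict s)) := by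
  have hΩf : IsFiniteMeasure (volume.restrict Ω : Measure (Phase d)) :=
    ⟨by rw [Measure.restrict_apply_univ]; exact hΩ.measure_lt_top⟩
  have hsf : IsFiniteMeasure (volume.restrict s : Measure (RSpace d)) :=
    ⟨by rw [Measure.restrict_apply_univ]; exact hs⟩
  have hgm : StronglyMeasurable fun p : Phase d × RSpace d => g (p.2 - p.1.1) :=
    (Lp.stronglyMeasurable g).comp_measurable (by fun_prop)
  have hgsq : StronglyMeasurable fun p : Phase d × RSpace d => ‖g (p.2 - p.1.1)‖ ^ 2 :=
    hgm.norm.pow 2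
  have hsq : Integrable (fun p : Phase d × RSpace d => ‖g (p.2 - p.1.1)‖ ^ 2)
      ((volume.restrict Ω).prod (volume.restrict s)) := by
    refine ⟨hgsq.aestronglyMeasurable, ?_⟩
    rw [hasFiniteIntegral_iff_ofReal (ae_of_all _ fun p => by positivity),
      lintegral_prod _ hgsq.measurable.ennreal_ofReal.aemeasurable]
    calc ∫⁻ z in Ω, ∫⁻ t in s, ENNReal.ofReal (‖g (t - z.1)‖ ^ 2)
        ≤ ∫⁻ _ in Ω, ENNReal.ofReal (‖g‖ ^ 2) := by
          refine lintegral_mono fun z => ?_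
          refine (setLIntegral_le_lintegral s _).trans (le_of_eq ?_)
          rw [lintegral_sub_right_eq_self (fun t => ENNReal.ofReal (‖g t‖ ^ 2)),
            ← L2.lintegral_enorm_sq]
          refine lintegral_congr fun t => ?_
          rw [ENNReal.ofReal_pow (norm_nonneg _), ofReal_norm]
      _ < ⊤ := by
          rw [lintegral_const]
          exact ENNReal.mul_lt_top ENNReal.ofReal_lt_top (measure_lt_top _ _)
  -- The majorant comes from `s ≤ 1 + s²`: the constant is integrable on a finite measure space, and
  -- the square by the preceding step.
  refine (((integrable_const (1 : ℝ)).add hsq).const_mul (‖g‖ * ‖f‖)).mono' ?_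
    (ae_of_all _ fun p => ?_)
  · refine AEStronglyMeasurable.mul (AEStronglyMeasurable.mul ?_ hgm.aestronglyMeasurable) ?_
    · exact ((continuous_stft g f).comp continuous_fst).aestronglyMeasurable
    · exact (continuous_tfChar.comp (by fun_prop : Continuous fun p : Phase d × RSpace d =>
        (p.1.2, p.2))).aestronglyMeasurable
  · rw [norm_mul, norm_mul, norm_tfChar, mul_one]
    refine mul_le_mul (norm_stft_le g f p.1) ?_ (norm_nonneg _) (by positivity)
    simp only [Pi.add_apply]
    nlinarith [sq_nonneg (‖g (p.2 - p.1.1)‖ - 1)]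

/-- The pointwise integral defining the localization operator agrees with the operator on `L²`. -/
theorem locOpCLM_ae_eq (g : L2 d) {Ω : Set (Phase d)} (hΩ : IsCompact Ω) (f : L2 d) :
    locOpCLM g Ω f =ᵐ[volume] locOp g Ω f := by
  have hloc : ∀ t, locOp g Ω f t = ∫ z in Ω, stft g f z * g (t - z.1) * tfChar z.2 t :=
    fun t => rfl
  -- Equality is tested on sets of finite measure: pairing with an indicator function turns the
  -- claim into Fubini.
  refine ae_eq_of_forall_setIntegral_eq_of_sigmaFinite (fun s hs hsf => ?_) (fun s hs hsf => ?_)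
    fun s hs hsf => ?_
  · have : IsFiniteMeasure (volume.restrict s : Measure (RSpace d)) :=
      ⟨by rw [Measure.restrict_apply_univ]; exact hsf⟩
    exact ((Lp.memLp (locOpCLM g Ω f)).restrict s).integrable (by norm_num)
  · simp_rw [IntegrableOn, funext hloc]
    exact (integrable_locOp_kernel g f hΩ hsf).integral_prod_right
  · rw [← L2.inner_indicatorConstLp_one hs hsf.ne, inner_locOpCLM g hΩ]
    have h1 : ∀ z, stft g f z * inner ℂ (indicatorConstLp 2 hs hsf.ne (1 : ℂ)) (tfShift g z)
        = ∫ t in s, stft g f z * g (t - z.1) * tfChar z.2 t := by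
      intro z
      rw [L2.inner_indicatorConstLp_one, ← integral_const_mul]
      refine integral_congr_ae (ae_restrict_of_ae ?_)
      filter_upwards [coeFn_tfShift g z] with t ht
      rw [ht]; ring
    simp_rw [h1, hloc]
    exact integral_integral_swap (integrable_locOp_kernel g f hΩ hsf)

end LocalizationOperator

/-! ### Infinite rank and existence of the eigensystem -/

section InfiniteRank

open Filter Topology

variable {d : ℕ}

theorem volume_hyperplane (i : Fin d) (c : ℝ) : volume {t : RSpace d | t i = c} = 0 := by
  have h2 : volume {t : Fin d → ℝ | t i = c} = 0 := by
    rw [volume_pi]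
    exact Measure.pi_hyperplane (α := fun _ : Fin d => ℝ) (fun _ => volume) i c
  have h3 : MeasurableSet {t : Fin d → ℝ | t i = c} :=
    measurableSet_eq_fun (measurable_pi_apply i) measurable_const
  rwa [← (PiLp.volume_preserving_ofLp (Fin d)).measure_preimage h3.nullMeasurableSet] at h2

/-- On a level set `ε t_i` is determined up to an integer, so the set lies in countably many
parallel hyperplanes. -/
theorem volume_tfChar_eq {i : Fin d} {ε : ℝ} (hε : ε ≠ 0) (w : ℂ) :
    volume {t : RSpace d | tfChar (EuclideanSpace.single i ε) t = w} = 0 := by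
  by_cases h : ∃ t₀ : RSpace d, tfChar (EuclideanSpace.single i ε) t₀ = w
  · obtain ⟨t₀, rfl⟩ := h
    refine measure_mono_null (t := ⋃ n : ℤ, {t : RSpace d | t i = t₀ i + n / ε}) ?_
      (measure_iUnion_null fun n => volume_hyperplane i _)
    intro t ht
    simp only [Set.mem_ofPred_eq, tfChar, Complex.exp_eq_exp_iff_exists_int] at ht
    obtain ⟨n, hn⟩ := ht
    have hpi : (2 * (Real.pi : ℂ) * Complex.I) ≠ 0 := by
      simp [Real.pi_ne_zero]
    have h2 : ((inner ℝ (EuclideanSpace.single i ε) t : ℝ) : ℂ)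
        = ((inner ℝ (EuclideanSpace.single i ε) t₀ + n : ℝ) : ℂ) := by
      apply mul_left_cancel₀ hpi
      rw [hn]; push_cast; ring
    have h3 : t i * ε = t₀ i * ε + n := by
      have := Complex.ofReal_injective h2
      simpa [EuclideanSpace.inner_single_left, mul_comm] using this
    refine Set.mem_iUnion.mpr ⟨n, ?_⟩
    simp only [Set.mem_ofPred_eq]
    field_simp
    linarith
  · push Not at h
    simp [h]

theorem tfChar_nsmul (η t : RSpace d) (n : ℕ) : tfChar ((n : ℝ) • η) t = tfChar η t ^ n := by
  rw [tfChar, tfChar, ← Complex.exp_nat_mul, inner_smul_left]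
  congr 1
  push_cast
  simp only [conj_trivial]
  push_cast
  ring

/-- Modulations of a nonzero function by multiples of one frequency are linearly independent. -/
theorem linearIndependent_tfShift {g : L2 d} (hg : g ≠ 0) {i : Fin d} {ε : ℝ} (hε : ε ≠ 0)
    (n : ℕ) : LinearIndependent ℂ
      fun j : Fin n => tfShift g (0, ((j : ℕ) : ℝ) • EuclideanSpace.single i ε) := by
  rw [Fintype.linearIndependent_iff]
  intro c hc
  -- A linear relation reads `P(e^{2πi ε t_i}) g(t) = 0` almost everywhere. A nonzero `P` has
  -- finitely many roots, each attained on a null set only, so `g` would vanish.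
  set P : Polynomial ℂ := ∑ j : Fin n, Polynomial.C (c j) * Polynomial.X ^ (j : ℕ) with hP
  have hae : ∀ᵐ t : RSpace d, P.eval (tfChar (EuclideanSpace.single i ε) t) * g t = 0 := by
    have h1 : ∀ᵐ t : RSpace d, ∀ j : Fin n,
        tfShift g (0, ((j : ℕ) : ℝ) • EuclideanSpace.single i ε) t
          = tfChar (EuclideanSpace.single i ε) t ^ (j : ℕ) * g t := by
      rw [ae_all_iff]
      intro j
      filter_upwards [coeFn_tfShift g (0, ((j : ℕ) : ℝ) • EuclideanSpace.single i ε)] with t ht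
      rw [ht, tfChar_nsmul, sub_zero]
    have h2 : ∀ᵐ t : RSpace d, ∀ j : Fin n,
        (c j • tfShift g (0, ((j : ℕ) : ℝ) • EuclideanSpace.single i ε) : L2 d) t
          = c j * tfShift g (0, ((j : ℕ) : ℝ) • EuclideanSpace.single i ε) t := by
      rw [ae_all_iff]
      intro j
      filter_upwards [Lp.coeFn_smul (c j)
        (tfShift g (0, ((j : ℕ) : ℝ) • EuclideanSpace.single i ε))] with t ht
      rw [ht]; rfl
    have h3 := Lp.coeFn_zero ℂ 2 (volume : Measure (RSpace d))
    rw [← hc] at h3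
    filter_upwards [h1, h2, h3, Lp.coeFn_finsetSum Finset.univ fun j : Fin n =>
      c j • tfShift g (0, ((j : ℕ) : ℝ) • EuclideanSpace.single i ε)] with t h1 h2 h3 h4
    rw [h4] at h3
    rw [hP, Polynomial.eval_finsetSum, Finset.sum_mul]
    simp only [Finset.sum_apply, h2, h1, Pi.zero_apply] at h3
    rw [← h3]
    refine Finset.sum_congr rfl fun j _ => ?_
    simp [mul_assoc]
  have hP0 : P = 0 := by
    by_contra hP0
    have hroots : ∀ᵐ t : RSpace d, P.eval (tfChar (EuclideanSpace.single i ε) t) ≠ 0 := by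
      rw [ae_iff]
      refine measure_mono_null (t := ⋃ w ∈ P.roots.toFinset,
        {t : RSpace d | tfChar (EuclideanSpace.single i ε) t = w}) ?_
        ((measure_biUnion_null_iff P.roots.toFinset.countable_toSet).mpr
          fun w _ => volume_tfChar_eq hε w)
      intro t ht
      simp only [Set.mem_ofPred_eq, not_not] at ht
      simp [hP0, ht]
    apply hg
    refine Lp.ext ?_
    filter_upwards [hae, hroots, Lp.coeFn_zero ℂ 2 (volume : Measure (RSpace d))] with t h1 h2 h3
    rw [h3]
    exact (mul_eq_zero.mp h1).resolve_left h2
  intro j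
  have := congrArg (fun Q => Polynomial.coeff Q (j : ℕ)) hP0
  simpa [hP, Polynomial.coeff_X_pow, Fin.val_inj] using this

/-- Localization to a set with interior has infinite rank. -/
theorem exists_locOpCLM_ne_zero (hd : 1 ≤ d) {g : L2 d} (hg : g ≠ 0) {Ω : Set (Phase d)}
    (hΩ : IsCompact Ω) (h0 : Ω ∈ 𝓝 (0 : Phase d)) (n : ℕ) (v : ℕ → L2 d) :
    ∃ f : L2 d, (∀ k < n, inner ℂ (v k) f = 0) ∧ locOpCLM g Ω f ≠ 0 := by
  by_contra! hcon
  set K : Submodule ℂ (L2 d) := Submodule.span ℂ (Set.range fun k : Fin n => v k) with hK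
  have hKf : FiniteDimensional ℂ K := FiniteDimensional.span_of_finite ℂ (Set.finite_range _)
  -- For `f` orthogonal to `K` the spectrogram integrates to 0 over `Ω`, so by continuity it
  -- vanishes on the interior, where `f` is therefore orthogonal to every shift of `g`.
  -- Finite-dimensionality gives `Kᗮᗮ = K`.
  have hmem : ∀ z ∈ interior Ω, tfShift g z ∈ K := by
    intro z hz
    rw [← K.orthogonal_orthogonal, Submodule.mem_orthogonal']
    intro f hf
    have hf' : locOpCLM g Ω f = 0 := hcon f fun k hk =>
      (Submodule.mem_orthogonal K f).mp hf _ (Submodule.subset_span ⟨⟨k, hk⟩, rfl⟩)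
    have h1 := inner_locOpCLM_self g hΩ f
    rw [hf', inner_zero_right] at h1
    have h2 : ∫ w in Ω, spectrogram g f w = 0 := by exact_mod_cast h1.symm
    by_contra hne
    have hpos : 0 < ∫ w in Ω, spectrogram g f w := by
      rw [setIntegral_pos_iff_support_of_nonneg_ae (ae_of_all _ (spectrogram_nonneg g f))
        (integrable_spectrogram g f).integrableOn]
      have hopen : IsOpen (Function.support (spectrogram g f) ∩ interior Ω) :=
        (continuous_spectrogram g f).isOpen_support.inter isOpen_interior
      have hzm : z ∈ Function.support (spectrogram g f) ∩ interior Ω := by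
        refine ⟨?_, hz⟩
        rw [Function.mem_support, spectrogram_eq]
        exact pow_ne_zero 2 (norm_ne_zero_iff.mpr hne)
      refine lt_of_lt_of_le ?_ (measure_mono (Set.inter_subset_inter_right _ interior_subset))
      rw [Measure.volume_eq_prod]
      exact hopen.measure_pos _ ⟨z, hzm⟩
    exact hpos.ne' h2
  let i : Fin d := ⟨0, hd⟩
  have hcont : Continuous fun ε : ℝ => fun j : Fin (n + 1) =>
      ((0, ((j : ℕ) : ℝ) • EuclideanSpace.single i ε) : Phase d) := by
    have : Continuous fun ε : ℝ => (EuclideanSpace.single i ε : RSpace d) := by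
      have h : (fun ε : ℝ => (EuclideanSpace.single i ε : RSpace d))
          = fun ε => ε • EuclideanSpace.single i 1 := by
        ext ε j
        simp
      rw [h]
      fun_prop
    fun_prop
  -- For small `ε` all `n + 1` shifts lie in the interior, giving `n + 1` independent vectors in a
  -- space of dimension at most `n`.
  have hev : ∀ᶠ ε : ℝ in 𝓝 0, ∀ j : Fin (n + 1),
      ((0, ((j : ℕ) : ℝ) • EuclideanSpace.single i ε) : Phase d) ∈ interior Ω := by
    rw [eventually_all]
    intro j
    have h1 := ((continuous_apply j).comp hcont).tendsto 0
    have h2 : interior Ω ∈ 𝓝 ((0 : Phase d)) := interior_mem_nhds.mpr h0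
    refine h1 ?_
    have h3 : (EuclideanSpace.single i 0 : RSpace d) = 0 := by ext j; simp
    simp only [Function.comp_apply, h3, smul_zero]
    exact h2
  obtain ⟨ε, hε, hε0⟩ := ((hev.filter_mono nhdsWithin_le_nhds).and
    (self_mem_nhdsWithin (a := (0 : ℝ)) (s := {0}ᶜ))).exists
  have hli := linearIndependent_tfShift hg (i := i) (Set.mem_compl_singleton_iff.mp hε0) (n + 1)
  have hli' : LinearIndependent ℂ fun j : Fin (n + 1) =>
      (⟨tfShift g (0, ((j : ℕ) : ℝ) • EuclideanSpace.single i ε), hmem _ (hε j)⟩ : K) :=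
    LinearIndependent.of_comp K.subtype hli
  have h1 := hli'.fintype_card_le_finrank
  have h2 : Module.finrank ℂ K ≤ n := by
    have := finrank_range_le_card (R := ℂ) fun k : Fin n => v k
    rwa [Fintype.card_fin] at this
  rw [Fintype.card_fin] at h1
  omega

/-- The localization operator of a compact neighbourhood of the origin is diagonalizable, with
infinitely many positive eigenvalues. -/
theorem exists_isEigensystem (hd : 1 ≤ d) {g : L2 d} (hg : g ≠ 0) {Ω : Set (Phase d)}
    (hΩ : IsCompact Ω) (h0 : Ω ∈ 𝓝 (0 : Phase d)) :
    ∃ (lam : ℕ → ℝ) (h : ℕ → L2 d), IsEigensystem g Ω lam h := by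
  obtain ⟨lam, h, h1, h2, h3, h4⟩ := exists_eigensystem_of_isPositive
    (isCompactOperator_locOpCLM g hΩ) (isPositive_locOpCLM g hΩ) (exists_locOpCLM_ne_zero hd hg hΩ h0)
  exact ⟨lam, h, h1, h2, h3, fun f => ⟨_, locOpCLM_ae_eq g hΩ f, h4 f⟩⟩

theorem IsEigensystem.hasSum {g : L2 d} {Ω : Set (Phase d)} {lam : ℕ → ℝ} {h : ℕ → L2 d}
    (he : IsEigensystem g Ω lam h) (hΩ : IsCompact Ω) (f : L2 d) :
    HasSum (fun k => ((lam k : ℂ) * inner ℂ (h k) f) • h k) (locOpCLM g Ω f) := by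
  obtain ⟨F, hF, hsum⟩ := he.diagonalizes f
  have : locOpCLM g Ω f = F := Lp.ext ((locOpCLM_ae_eq g hΩ f).trans hF.symm)
  rwa [this]

end InfiniteRank

/-! ### An inequality for monotone sequences in `[0, 1]` -/

section EigenvalueSums

/-- For a non-increasing sequence in `[0, 1]` with sum `m`, the distance to the indicator sequence
of the first `⌈m⌉` indices is comparable to `∑ a k (1 - a k)`. -/
theorem Antitone.tsum_mul_one_sub_bounds {a : ℕ → ℝ} (ha : Antitone a) (h0 : ∀ k, 0 ≤ a k)
    (h1 : ∀ k, a k ≤ 1) {m : ℝ} (hm : HasSum a m) :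
    Summable (fun k => a k * (1 - a k)) ∧
    ∑' k, a k * (1 - a k) ≤ ⌈m⌉₊ + m - 2 * ∑ k ∈ Finset.range ⌈m⌉₊, a k ∧
    ⌈m⌉₊ + m - 2 * ∑ k ∈ Finset.range ⌈m⌉₊, a k ≤ 2 * ∑' k, a k * (1 - a k) + 1 ∧
    ⌈m⌉₊ - m ≤ ⌈m⌉₊ + m - 2 * ∑ k ∈ Finset.range ⌈m⌉₊, a k := by
  have hD : Summable (fun k => a k * (1 - a k)) :=
    Summable.of_nonneg_of_le (fun k => mul_nonneg (h0 k) (sub_nonneg.mpr (h1 k)))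
      (fun k => by nlinarith [h0 k, h1 k]) hm.summable
  have hm0 : 0 ≤ m := hm.nonneg h0
  set A := ⌈m⌉₊ with hA
  have hAm : m ≤ A := Nat.le_ceil m
  have hAm1 : (A : ℝ) < m + 1 := Nat.ceil_lt_add_one hm0
  have hsplit := hm.summable.sum_add_tsum_nat_add A
  have hDsplit := hD.sum_add_tsum_nat_add A
  rw [hm.tsum_eq] at hsplit
  set P := ∑ k ∈ Finset.range A, a k
  set S := ∑' k, a (k + A)
  have hsumS : Summable fun k => a (k + A) := (summable_nat_add_iff A).mpr hm.summable
  have hsumD : Summable fun k => a (k + A) * (1 - a (k + A)) := (summable_nat_add_iff A).mpr hD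
  have hS0 : 0 ≤ S := tsum_nonneg fun k => h0 _
  have hone : ∑ k ∈ Finset.range A, (1 - a k) = A - P := by
    rw [Finset.sum_sub_distrib]; simp [P]
  have hfirst : ∑ k ∈ Finset.range A, a k * (1 - a k) ≤ A - P := by
    rw [← hone]
    exact Finset.sum_le_sum fun k _ => by nlinarith [h0 k, h1 k]
  have hsecond : ∑' k, a (k + A) * (1 - a (k + A)) ≤ S :=
    hsumD.tsum_le_tsum (fun k => by nlinarith [h0 (k + A), h1 (k + A)]) hsumS
  -- The last kept value `c = a (A - 1)` separates kept from dropped terms, so the sum is at least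
  -- `c (A - P) + (1 - c) S`, and `A - P ≥ m - P = S`. For `A = 0` there is no such index, but then
  -- `m = 0`.
  have hlow : S ≤ ∑' k, a k * (1 - a k) := by
    rcases Nat.eq_zero_or_pos A with hA0 | hApos
    · have hm00 : m = 0 := le_antisymm (by rw [hA0] at hAm; simpa using hAm) hm0
      have hP : 0 ≤ P := Finset.sum_nonneg fun k _ => h0 k
      have hS : S ≤ 0 := by linarith
      exact hS.trans (tsum_nonneg fun k => mul_nonneg (h0 k) (sub_nonneg.mpr (h1 k)))
    · set c := a (A - 1) with hc
      have hf : c * (A - P) ≤ ∑ k ∈ Finset.range A, a k * (1 - a k) := by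
        rw [← hone, Finset.mul_sum]
        refine Finset.sum_le_sum fun k hk => ?_
        have hk' : k ≤ A - 1 := by have := Finset.mem_range.mp hk; omega
        exact mul_le_mul_of_nonneg_right (ha hk') (sub_nonneg.mpr (h1 k))
      have hs : (1 - c) * S ≤ ∑' k, a (k + A) * (1 - a (k + A)) := by
        rw [← tsum_mul_left]
        refine (hsumS.mul_left _).tsum_le_tsum (fun k => ?_) hsumD
        have hk' : a (k + A) ≤ c := ha (by omega)
        nlinarith [h0 (k + A)]
      nlinarith [h0 (A - 1), mul_le_mul_of_nonneg_left (show S ≤ A - P by linarith) (h0 (A - 1))]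
  -- The middle quantity is both `(A - P) + S` and `2 S + (A - m)`, with `0 ≤ A - m < 1`.
  refine ⟨hD, ?_, ?_, ?_⟩ <;> linarith

end EigenvalueSums

/-! ### Trace identities and the `L¹` error -/

section Eigensystem

instance Phase.isAddHaarMeasure_volume (d : ℕ) : (volume : Measure (Phase d)).IsAddHaarMeasure := by
  rw [Measure.volume_eq_prod]; infer_instance

instance Phase.isNegInvariant_volume (d : ℕ) : (volume : Measure (Phase d)).IsNegInvariant := by
  have h : (volume : Measure (Phase d)).Regular := inferInstance
  exact Measure.IsAddHaarMeasure.isNegInvariant_of_regular _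

variable {d : ℕ} {g : L2 d} {Ω : Set (Phase d)} {lam : ℕ → ℝ} {h : ℕ → L2 d}

/-- The diagonalization paired with `f`. Taking `f = h k` yields the eigenvalues, taking `f =
tfShift g z` a pointwise identity for the spectrograms. -/
theorem IsEigensystem.hasSum_setIntegral_spectrogram (he : IsEigensystem g Ω lam h)
    (hΩ : IsCompact Ω) (f : L2 d) :
    HasSum (fun k => lam k * ‖inner ℂ (h k) f‖ ^ 2) (∫ z in Ω, spectrogram g f z) := by
  have h1 := (he.hasSum hΩ f).mapL (innerSL ℂ f)
  rw [innerSL_apply_apply, inner_locOpCLM_self g hΩ] at h1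
  rw [← Complex.hasSum_ofReal]
  have h2 : ∀ k, innerSL ℂ f (((lam k : ℂ) * inner ℂ (h k) f) • h k)
      = ((lam k * ‖inner ℂ (h k) f‖ ^ 2 : ℝ) : ℂ) := by
    intro k
    rw [innerSL_apply_apply, inner_smul_right, mul_assoc, ← inner_conj_symm f, RCLike.mul_conj]
    push_cast
    rfl
  simp_rw [h2] at h1
  exact h1

theorem IsEigensystem.eigenvalue_eq (he : IsEigensystem g Ω lam h) (hΩ : IsCompact Ω) (k : ℕ) :
    lam k = ∫ z in Ω, spectrogram g (h k) z := by
  have h1 := he.hasSum_setIntegral_spectrogram hΩ (h k)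
  have h2 : HasSum (fun j => lam j * ‖inner ℂ (h j) (h k)‖ ^ 2) (lam k) := by
    have h3 := hasSum_single (f := fun j => lam j * ‖inner ℂ (h j) (h k)‖ ^ 2) k fun j hj => by
      rw [he.orthonormal.2 hj]; simp
    have h4 : ‖inner ℂ (h k) (h k)‖ = 1 := by
      rw [inner_self_eq_norm_sq_to_K, he.orthonormal.1 k]; simp
    simpa only [h4, one_pow, mul_one] using h3
  exact h2.unique h1

theorem IsEigensystem.integral_spectrogram_eq_one (he : IsEigensystem g Ω lam h) (hg : ‖g‖ = 1)
    (k : ℕ) : ∫ z, spectrogram g (h k) z = 1 := by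
  rw [integral_spectrogram, hg, he.orthonormal.1 k]; norm_num

theorem IsEigensystem.eigenvalue_le_one (he : IsEigensystem g Ω lam h) (hg : ‖g‖ = 1)
    (hΩ : IsCompact Ω) (k : ℕ) : lam k ≤ 1 := by
  rw [he.eigenvalue_eq hΩ, ← he.integral_spectrogram_eq_one hg k]
  exact setIntegral_le_integral (integrable_spectrogram g (h k))
    (ae_of_all _ (spectrogram_nonneg g (h k)))

theorem IsEigensystem.hasSum_spectrogram (he : IsEigensystem g Ω lam h) (hΩ : IsCompact Ω)
    (z : Phase d) :
    HasSum (fun k => lam k * spectrogram g (h k) z) (∫ w in Ω, spectrogram g g (w - z)) := by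
  have h1 := he.hasSum_setIntegral_spectrogram hΩ (tfShift g z)
  simp_rw [spectrogram_tfShift] at h1
  convert h1 using 2 with k
  rw [spectrogram_eq, norm_inner_symm]

theorem integrable_spectrogram_sub (z : Phase d) :
    Integrable fun w => spectrogram g g (w - z) := by
  simp_rw [← spectrogram_tfShift]
  exact integrable_spectrogram g _

/-- Integrating the weighted sum of the spectrograms over a set. -/
theorem IsEigensystem.tsum_lintegral (he : IsEigensystem g Ω lam h) (hΩ : IsCompact Ω)
    (U : Set (Phase d)) :
    ∑' k, ENNReal.ofReal (lam k) * ∫⁻ z in U, ENNReal.ofReal (spectrogram g (h k) z)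
      = ∫⁻ z in U, ∫⁻ w in Ω, ENNReal.ofReal (spectrogram g g (w - z)) := by
  have hmeas : ∀ k, Measurable fun z => ENNReal.ofReal (spectrogram g (h k) z) := fun k =>
    (continuous_spectrogram g (h k)).measurable.ennreal_ofReal
  simp_rw [← lintegral_const_mul _ (hmeas _)]
  rw [← lintegral_tsum fun k => ((hmeas k).const_mul _).aemeasurable]
  refine lintegral_congr fun z => ?_
  have h1 := he.hasSum_spectrogram hΩ z
  rw [← ofReal_integral_eq_lintegral_ofReal (integrable_spectrogram_sub z).integrableOn
    (ae_of_all _ fun w => spectrogram_nonneg g g _), ← h1.tsum_eq,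
    ENNReal.ofReal_tsum_of_nonneg (fun k => mul_nonneg (he.pos k).le (spectrogram_nonneg _ _ _))
      h1.summable]
  exact tsum_congr fun k => (ENNReal.ofReal_mul (he.pos k).le).symm

theorem lintegral_spectrogram_const_sub (hg : ‖g‖ = 1) (w : Phase d) :
    ∫⁻ z, ENNReal.ofReal (spectrogram g g (w - z)) = 1 := by
  rw [lintegral_sub_left_eq_self (fun z => ENNReal.ofReal (spectrogram g g z)),
    lintegral_spectrogram, hg]
  simp

theorem measurable_spectrogram_sub : Measurable fun p : Phase d × Phase d =>
    ENNReal.ofReal (spectrogram g g (p.2 - p.1)) :=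
  ((continuous_spectrogram g g).comp (continuous_snd.sub continuous_fst)).measurable.ennreal_ofReal

/-- The trace of the localization operator is the measure of the set. -/
theorem IsEigensystem.hasSum_eigenvalues (he : IsEigensystem g Ω lam h) (hg : ‖g‖ = 1)
    (hΩ : IsCompact Ω) : HasSum lam (volume Ω).toReal := by
  -- Over the whole phase space every spectrogram involved has mass 1. Working in `ENNReal` makes
  -- summability a conclusion.
  have h1 := he.tsum_lintegral hΩ Set.univ
  simp only [Measure.restrict_univ, lintegral_spectrogram, hg, he.orthonormal.1] at h1
  rw [lintegral_lintegral_swap measurable_spectrogram_sub.aemeasurable] at h1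
  simp only [lintegral_spectrogram_const_sub hg, lintegral_one, Measure.restrict_apply_univ,
    one_pow, mul_one, ENNReal.ofReal_one] at h1
  have h2 : Summable lam := by
    have h3 : ∑' k, ENNReal.ofReal (lam k) ≠ ⊤ := by
      rw [h1]; exact hΩ.measure_ne_top
    have h4 := ENNReal.summable_toReal h3
    simpa only [ENNReal.toReal_ofReal (he.pos _).le] using h4
  have h5 : (volume Ω).toReal = ∑' k, lam k := by
    rw [← h1, ← ENNReal.ofReal_tsum_of_nonneg (fun k => (he.pos k).le) h2,
      ENNReal.toReal_ofReal (tsum_nonneg fun k => (he.pos k).le)]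
  rw [h5]
  exact h2.hasSum

/-- The trace of `H - H²` as an average of the measures of `Ω \ (Ω + u)`. -/
theorem IsEigensystem.tsum_mul_one_sub (he : IsEigensystem g Ω lam h) (hg : ‖g‖ = 1)
    (hΩ : IsCompact Ω) :
    ∑' k, ENNReal.ofReal (lam k * (1 - lam k))
      = ∫⁻ u, ENNReal.ofReal (spectrogram g g u) * volume (Ω \ {w | w - u ∈ Ω}) := by
  have hΩm : MeasurableSet Ω := hΩ.measurableSet
  -- `1 - lam k` is the mass of the `k`-th spectrogram outside `Ω`, so the trace is the weighted sum
  -- of spectrograms integrated over `Ωᶜ`.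
  have hleft : ∀ k, ENNReal.ofReal (lam k * (1 - lam k))
      = ENNReal.ofReal (lam k) * ∫⁻ z in Ωᶜ, ENNReal.ofReal (spectrogram g (h k) z) := by
    intro k
    rw [ENNReal.ofReal_mul (he.pos k).le, ← ofReal_integral_eq_lintegral_ofReal
      (integrable_spectrogram g (h k)).integrableOn (ae_of_all _ (spectrogram_nonneg g (h k)))]
    congr 2
    rw [he.eigenvalue_eq hΩ k, ← he.integral_spectrogram_eq_one hg k,
      ← integral_add_compl hΩm (integrable_spectrogram g (h k))]
    ring
  simp_rw [hleft]
  rw [he.tsum_lintegral hΩ, lintegral_lintegral_swap measurable_spectrogram_sub.aemeasurable]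
  have hΦ : Measurable fun u => ENNReal.ofReal (spectrogram g g u) :=
    (continuous_spectrogram g g).measurable.ennreal_ofReal
  have hind : Measurable (Ωᶜ.indicator (1 : Phase d → ENNReal)) :=
    measurable_one.indicator hΩm.compl
  have hinner : ∀ w : Phase d, ∫⁻ z in Ωᶜ, ENNReal.ofReal (spectrogram g g (w - z))
      = ∫⁻ u, ENNReal.ofReal (spectrogram g g u) * Ωᶜ.indicator 1 (w - u) := by
    intro w
    -- The substitution `z = w - u` frees the weight from `w`.
    rw [← lintegral_indicator hΩm.compl, ← lintegral_sub_left_eq_self _ w]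
    refine lintegral_congr fun u => ?_
    by_cases hu : w - u ∈ Ωᶜ <;> simp [hu, Set.indicator]
  simp_rw [hinner]
  have hm : Measurable fun p : Phase d × Phase d =>
      ENNReal.ofReal (spectrogram g g p.2) * Ωᶜ.indicator (1 : Phase d → ENNReal) (p.1 - p.2) :=
    (hΦ.comp measurable_snd).mul (hind.comp (measurable_fst.sub measurable_snd))
  rw [lintegral_lintegral_swap hm.aemeasurable]
  refine lintegral_congr fun u => ?_
  have hm2 : Measurable fun w : Phase d => Ωᶜ.indicator (1 : Phase d → ENNReal) (w - u) :=
    hind.comp (measurable_id.sub measurable_const)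
  rw [lintegral_const_mul _ hm2]
  congr 1
  have hset : MeasurableSet {w : Phase d | w - u ∈ Ω} :=
    hΩm.preimage (measurable_id.sub measurable_const)
  have : ∀ w : Phase d, Ωᶜ.indicator (1 : Phase d → ENNReal) (w - u)
      = {w : Phase d | w - u ∈ Ω}ᶜ.indicator 1 w := fun w => by
    by_cases hw : w - u ∈ Ω <;> simp [hw]
  simp_rw [this]
  rw [lintegral_indicator_one hset.compl, Measure.restrict_apply hset.compl, Set.inter_comm]
  rfl

/-- Bessel's inequality for the unit vector `tfShift g z`. -/
theorem IsEigensystem.accumulatedSpectrogram_le_one (he : IsEigensystem g Ω lam h) (hg : ‖g‖ = 1)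
    (z : Phase d) : accumulatedSpectrogram g Ω h z ≤ 1 := by
  have h1 := he.orthonormal.sum_inner_products_le (tfShift g z)
    (s := Finset.range ⌈(volume Ω).toReal⌉₊)
  rw [norm_tfShift, hg] at h1
  refine le_trans (le_of_eq ?_) (h1.trans (by norm_num))
  rw [accumulatedSpectrogram]
  exact Finset.sum_congr rfl fun k _ => by rw [spectrogram_eq, norm_inner_symm]

theorem accumulatedSpectrogram_nonneg (z : Phase d) : 0 ≤ accumulatedSpectrogram g Ω h z :=
  Finset.sum_nonneg fun k _ => spectrogram_nonneg g (h k) z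

theorem integrable_accumulatedSpectrogram : Integrable (accumulatedSpectrogram g Ω h) :=
  integrable_finsetSum _ fun k _ => integrable_spectrogram g (h k)

theorem integrable_spectrogramError (hΩ : IsCompact Ω) : Integrable (spectrogramError g Ω h) :=
  integrable_accumulatedSpectrogram.sub
    ((integrable_indicator_iff hΩ.measurableSet).mpr
      (integrableOn_const hΩ.measure_ne_top))

/-- The `L¹` error of the accumulated spectrogram in terms of the eigenvalues. -/
theorem IsEigensystem.integral_abs_spectrogramError (he : IsEigensystem g Ω lam h) (hg : ‖g‖ = 1)
    (hΩ : IsCompact Ω) :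
    ∫ z, |spectrogramError g Ω h z| = ⌈(volume Ω).toReal⌉₊ + (volume Ω).toReal
      - 2 * ∑ k ∈ Finset.range ⌈(volume Ω).toReal⌉₊, lam k := by
  have hpt : ∀ z, |spectrogramError g Ω h z| = accumulatedSpectrogram g Ω h z
      + Ω.indicator (fun _ => (1 : ℝ)) z - 2 * Ω.indicator (accumulatedSpectrogram g Ω h) z := by
    intro z
    have h0 := accumulatedSpectrogram_nonneg (g := g) (Ω := Ω) (h := h) z
    have h1 := he.accumulatedSpectrogram_le_one hg z
    rw [spectrogramError]
    by_cases hz : z ∈ Ω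
    · rw [Set.indicator_of_mem hz, Set.indicator_of_mem hz, abs_of_nonpos (by linarith)]; ring
    · rw [Set.indicator_of_notMem hz, Set.indicator_of_notMem hz, sub_zero, abs_of_nonneg h0]; ring
  have hi1 : Integrable (accumulatedSpectrogram g Ω h) := integrable_accumulatedSpectrogram
  have hi2 : Integrable (Ω.indicator fun _ => (1 : ℝ)) :=
    (integrable_indicator_iff hΩ.measurableSet).mpr (integrableOn_const hΩ.measure_ne_top)
  have hi3 : Integrable (Ω.indicator (accumulatedSpectrogram g Ω h)) :=
    hi1.indicator hΩ.measurableSet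
  simp_rw [hpt]
  have hi12 : Integrable fun z => accumulatedSpectrogram g Ω h z
      + Ω.indicator (fun _ => (1 : ℝ)) z := hi1.add hi2
  rw [integral_sub hi12 (hi3.const_mul 2), integral_add hi1 hi2, integral_const_mul,
    integral_indicator hΩ.measurableSet, integral_indicator hΩ.measurableSet]
  have e1 : ∫ z, accumulatedSpectrogram g Ω h z = ⌈(volume Ω).toReal⌉₊ := by
    simp only [accumulatedSpectrogram]
    rw [integral_finsetSum _ fun k _ => integrable_spectrogram g (h k)]
    simp [he.integral_spectrogram_eq_one hg]
  have e2 : ∫ z in Ω, accumulatedSpectrogram g Ω h z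
      = ∑ k ∈ Finset.range ⌈(volume Ω).toReal⌉₊, lam k := by
    simp only [accumulatedSpectrogram]
    rw [integral_finsetSum _ fun k _ => (integrable_spectrogram g (h k)).integrableOn]
    exact Finset.sum_congr rfl fun k _ => (he.eigenvalue_eq hΩ k).symm
  rw [e1, e2]
  simp [Measure.real]

/-- Two-sided bounds for the `L¹` error by the trace of `H - H²`. -/
theorem IsEigensystem.error_bounds (he : IsEigensystem g Ω lam h) (hg : ‖g‖ = 1)
    (hΩ : IsCompact Ω) {D : ENNReal}
    (hD : D = ∫⁻ u, ENNReal.ofReal (spectrogram g g u) * volume (Ω \ {w | w - u ∈ Ω})) :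
    D ≠ ⊤ ∧ D.toReal ≤ ∫ z, |spectrogramError g Ω h z| ∧
    ∫ z, |spectrogramError g Ω h z| ≤ 2 * D.toReal + 1 ∧
    ⌈(volume Ω).toReal⌉₊ - (volume Ω).toReal ≤ ∫ z, |spectrogramError g Ω h z| := by
  obtain ⟨h1, h2, h3, h4⟩ := he.antitone.tsum_mul_one_sub_bounds (fun k => (he.pos k).le)
    (he.eigenvalue_le_one hg hΩ) (he.hasSum_eigenvalues hg hΩ)
  have hnn : ∀ k, 0 ≤ lam k * (1 - lam k) := fun k =>
    mul_nonneg (he.pos k).le (sub_nonneg.mpr (he.eigenvalue_le_one hg hΩ k))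
  rw [← he.tsum_mul_one_sub hg hΩ, ← ENNReal.ofReal_tsum_of_nonneg hnn h1] at hD
  rw [hD, ENNReal.toReal_ofReal (tsum_nonneg hnn), he.integral_abs_spectrogramError hg hΩ]
  exact ⟨ENNReal.ofReal_ne_top, h2, h3, h4⟩

end Eigensystem

/-! ### Balls and their translates -/

section PhaseBall

open Filter Topology
open scoped Pointwise

variable {d : ℕ}

theorem phaseNorm_eq (z : Phase d) : phaseNorm z = ‖WithLp.toLp 2 z‖ := by
  rw [phaseNorm, WithLp.prod_norm_eq_of_L2]
  rfl

theorem phaseNorm_nonneg (z : Phase d) : 0 ≤ phaseNorm z := Real.sqrt_nonneg _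

theorem phaseNorm_zero : phaseNorm (0 : Phase d) = 0 := by
  simp [phaseNorm]

theorem phaseNorm_smul (r : ℝ) (z : Phase d) : phaseNorm (r • z) = |r| * phaseNorm z := by
  rw [phaseNorm_eq, phaseNorm_eq, WithLp.toLp_smul, norm_smul, Real.norm_eq_abs]

theorem phaseNorm_sub_le (z w : Phase d) : phaseNorm (z - w) ≤ phaseNorm z + phaseNorm w := by
  rw [phaseNorm_eq, phaseNorm_eq, phaseNorm_eq, WithLp.toLp_sub]
  exact norm_sub_le _ _

theorem continuous_phaseNorm : Continuous (phaseNorm : Phase d → ℝ) := by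
  unfold phaseNorm
  fun_prop

theorem norm_le_phaseNorm (z : Phase d) : ‖z‖ ≤ phaseNorm z := by
  rw [phaseNorm, Prod.norm_def]
  refine max_le ?_ ?_ <;> refine Real.le_sqrt_of_sq_le ?_
  · nlinarith [sq_nonneg ‖z.2‖]
  · nlinarith [sq_nonneg ‖z.1‖]

theorem isCompact_phaseBall (R : ℝ) : IsCompact (phaseBall d R) := by
  refine (isCompact_closedBall (0 : Phase d) R).of_isClosed_subset
    (isClosed_le continuous_phaseNorm continuous_const) fun z hz => ?_
  rw [mem_closedBall_zero_iff]
  exact (norm_le_phaseNorm z).trans hz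

theorem phaseBall_mem_nhds {R : ℝ} (hR : 0 < R) : phaseBall d R ∈ 𝓝 (0 : Phase d) := by
  have h : ∀ᶠ z in 𝓝 (0 : Phase d), phaseNorm z < R :=
    continuous_phaseNorm.continuousAt.eventually_lt continuousAt_const (by rwa [phaseNorm_zero])
  exact h.mono fun z hz => hz.le

theorem volume_phaseBall {R : ℝ} (hR : 0 < R) :
    (volume (phaseBall d R)).toReal = (volume (phaseBall d 1)).toReal * R ^ (2 * d) := by
  have hset : phaseBall d R = R • phaseBall d 1 := by
    ext z
    rw [Set.mem_smul_set_iff_inv_smul_mem₀ hR.ne']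
    simp only [phaseBall, Set.mem_ofPred_eq, phaseNorm_smul, abs_inv, abs_of_pos hR]
    rw [inv_mul_le_iff₀ hR, mul_one]
  rw [hset, Measure.addHaar_smul, ENNReal.toReal_mul, ENNReal.toReal_ofReal (abs_nonneg _),
    abs_of_pos (by positivity), Module.finrank_prod, finrank_euclideanSpace_fin, ← two_mul,
    mul_comm]

theorem volume_phaseBall_one_pos : 0 < (volume (phaseBall d 1)).toReal :=
  ENNReal.toReal_pos (Measure.measure_pos_of_mem_nhds _ (phaseBall_mem_nhds one_pos)).ne'
    (isCompact_phaseBall 1).measure_ne_top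

/-- Subadditivity of the measure of `Ω \ (Ω + u)` in `u`. -/
theorem measure_diff_add_le (Ω : Set (Phase d)) (u v : Phase d) :
    volume (Ω \ {w | w - (u + v) ∈ Ω})
      ≤ volume (Ω \ {w | w - u ∈ Ω}) + volume (Ω \ {w | w - v ∈ Ω}) := by
  have h1 : Ω \ {w | w - (u + v) ∈ Ω} ⊆ (Ω \ {w | w - u ∈ Ω}) ∪
      (fun w => w - u) ⁻¹' (Ω \ {w | w - v ∈ Ω}) := by
    intro w hw
    by_cases hwu : w - u ∈ Ω
    · refine Or.inr ⟨hwu, fun hv => hw.2 ?_⟩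
      rw [Set.mem_ofPred_eq, ← sub_sub]
      exact hv
    · exact Or.inl ⟨hw.1, hwu⟩
  refine (measure_mono h1).trans ((measure_union_le _ _).trans (le_of_eq ?_))
  simp_rw [sub_eq_add_neg _ u]
  rw [measure_preimage_add_right]

theorem measure_diff_nsmul_le (Ω : Set (Phase d)) (u : Phase d) (k : ℕ) :
    volume (Ω \ {w | w - k • u ∈ Ω}) ≤ k * volume (Ω \ {w | w - u ∈ Ω}) := by
  induction k with
  | zero => simp
  | succ k ih =>
    rw [succ_nsmul]
    refine (measure_diff_add_le Ω _ _).trans ?_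
    push_cast
    rw [add_mul, one_mul]
    gcongr

/-- Once `k |u| > 2R`, translation by `k u` makes the ball disjoint from itself; subadditivity then
shows that a single step `u` removes at least `|B_R| / k`. -/
theorem measure_phaseBall_diff_ge {R : ℝ} (hR : 0 < R) (u : Phase d) :
    (volume (phaseBall d R)).toReal * (phaseNorm u / (2 * R + phaseNorm u))
      ≤ (volume (phaseBall d R \ {w | w - u ∈ phaseBall d R})).toReal := by
  rcases (phaseNorm_nonneg u).eq_or_lt with h0 | h0
  · rw [← h0]; simp
  -- The least integer strictly above `2R / |u|`.
  set k := ⌊2 * R / phaseNorm u⌋₊ + 1 with hk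
  have hk1 : 2 * R / phaseNorm u < k := by rw [hk]; push_cast; exact Nat.lt_floor_add_one _
  have hk2 : (k : ℝ) ≤ 2 * R / phaseNorm u + 1 := by
    rw [hk]; push_cast
    gcongr
    exact Nat.floor_le (by positivity)
  have hdisj : phaseBall d R \ {w | w - k • u ∈ phaseBall d R} = phaseBall d R := by
    refine sdiff_eq_left.mpr (Set.disjoint_left.mpr fun w hw hw' => ?_)
    have h1 : phaseNorm w ≤ R := hw
    have h2 : phaseNorm (w - k • u) ≤ R := hw'
    have h3 := phaseNorm_sub_le w (w - k • u)
    rw [sub_sub_cancel, ← Nat.cast_smul_eq_nsmul ℝ, phaseNorm_smul, Nat.abs_cast] at h3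
    rw [div_lt_iff₀ h0] at hk1
    rw [Nat.cast_smul_eq_nsmul ℝ] at h3
    linarith
  have h1 := measure_diff_nsmul_le (phaseBall d R) u k
  have hfin : volume (phaseBall d R \ {w | w - u ∈ phaseBall d R}) ≠ ⊤ :=
    ((measure_mono Set.sdiff_subset).trans_lt (isCompact_phaseBall R).measure_lt_top).ne
  rw [hdisj] at h1
  have h2 := ENNReal.toReal_mono (ENNReal.mul_ne_top (ENNReal.natCast_ne_top k) hfin) h1
  rw [ENNReal.toReal_mul, ENNReal.toReal_natCast] at h2
  set F := (volume (phaseBall d R \ {w | w - u ∈ phaseBall d R})).toReal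
  have hF : 0 ≤ F := ENNReal.toReal_nonneg
  have h3 := h2.trans (mul_le_mul_of_nonneg_right hk2 hF)
  rw [← mul_div_assoc, div_le_iff₀ (by positivity)]
  calc (volume (phaseBall d R)).toReal * phaseNorm u
      ≤ (2 * R / phaseNorm u + 1) * F * phaseNorm u := by gcongr
    _ = F * (2 * R + phaseNorm u) := by field_simp

/-- Bernoulli's inequality at `-(t / R)`, scaled by `R ^ n`. -/
theorem pow_sub_sub_pow_le {R t : ℝ} (hR : 0 < R) (ht : t ≤ R) {n : ℕ} (hn : 1 ≤ n) :
    R ^ n - (R - t) ^ n ≤ n * t * R ^ (n - 1) := by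
  have hle : t / R ≤ 1 := (div_le_one hR).mpr ht
  have h := one_add_mul_le_pow (a := -(t / R)) (by linarith) n
  have h2 : (R - t) ^ n = R ^ n * (1 + -(t / R)) ^ n := by
    rw [← mul_pow]; congr 1; field_simp; ring
  have h3 : R ^ n = R * R ^ (n - 1) := by rw [← pow_succ', Nat.sub_add_cancel hn]
  have h4 : n * t * R ^ (n - 1) = R ^ n * (n * (t / R)) := by
    rw [h3]; field_simp
  rw [h2, h4]
  nlinarith [mul_le_mul_of_nonneg_left h (pow_nonneg hR.le n)]

/-- For `|u| < R` the ball and its translate share the ball of radius `R - |u|`, and Bernoulli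
bounds the rest. For `|u| ≥ R` the full volume already satisfies the bound. -/
theorem measure_phaseBall_diff_le (hd : 1 ≤ d) {R : ℝ} (hR : 0 < R) (u : Phase d) :
    (volume (phaseBall d R \ {w | w - u ∈ phaseBall d R})).toReal
      ≤ (volume (phaseBall d 1)).toReal * (2 * d * phaseNorm u * R ^ (2 * d - 1)) := by
  have hn : 1 ≤ 2 * d := by omega
  have hv := (volume_phaseBall_one_pos (d := d)).le
  have hRn : R ^ (2 * d) = R * R ^ (2 * d - 1) := by rw [← pow_succ', Nat.sub_add_cancel hn]
  have hd1 : (1 : ℝ) ≤ d := by exact_mod_cast hd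
  have hu := phaseNorm_nonneg u
  rcases le_or_gt R (phaseNorm u) with hRu | hRu
  · refine (ENNReal.toReal_mono (isCompact_phaseBall R).measure_ne_top
      (measure_mono Set.sdiff_subset)).trans ?_
    rw [volume_phaseBall hR, hRn]
    gcongr
    nlinarith
  · have hsub : phaseBall d (R - phaseNorm u) ⊆ phaseBall d R ∩ {w | w - u ∈ phaseBall d R} := by
      intro w hw
      have hw' : phaseNorm w ≤ R - phaseNorm u := hw
      refine ⟨show phaseNorm w ≤ R by linarith, show phaseNorm (w - u) ≤ R from ?_⟩
      linarith [phaseNorm_sub_le w u]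
    have hsub2 : phaseBall d R \ {w | w - u ∈ phaseBall d R}
        ⊆ phaseBall d R \ phaseBall d (R - phaseNorm u) := fun w hw =>
      ⟨hw.1, fun h => hw.2 (hsub h).2⟩
    refine (ENNReal.toReal_mono ((measure_mono Set.sdiff_subset).trans_lt
      (isCompact_phaseBall R).measure_lt_top).ne (measure_mono hsub2)).trans ?_
    have hdiff := measureReal_sdiff (μ := volume) (fun w hw => (hsub hw).1)
      (isCompact_phaseBall (d := d) (R - phaseNorm u)).measurableSet
      (isCompact_phaseBall (d := d) R).measure_ne_top
    rw [Measure.real, Measure.real, Measure.real, volume_phaseBall hR,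
      volume_phaseBall (sub_pos.mpr hRu)] at hdiff
    rw [hdiff, ← mul_sub]
    gcongr
    have := pow_sub_sub_pow_le hR hRu.le hn
    push_cast at this
    exact this

end PhaseBall

/-! ### The two bounds for balls -/

section Main

variable {d : ℕ}

/-- The measure of `B_R \ (B_R + u)` averaged over `u` against `|V_g g|²`; this is the trace of
`H - H²` for the ball `B_R`. -/
noncomputable def shiftDefect (g : L2 d) (R : ℝ) : ENNReal :=
  ∫⁻ u, ENNReal.ofReal (spectrogram g g u) *
    volume (phaseBall d R \ {w | w - u ∈ phaseBall d R})

theorem volume_phaseBall_diff_ne_top (R : ℝ) (u : Phase d) :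
    volume (phaseBall d R \ {w | w - u ∈ phaseBall d R}) ≠ ⊤ :=
  ((measure_mono Set.sdiff_subset).trans_lt (isCompact_phaseBall R).measure_lt_top).ne

theorem toReal_shiftDefect_le (hd : 1 ≤ d) {g : L2 d} (hM : MemMStar g) {R : ℝ} (hR : 0 < R) :
    (shiftDefect g R).toReal ≤ 2 * d * (volume (phaseBall d 1)).toReal *
      (∫ z, phaseNorm z * spectrogram g g z) * R ^ (2 * d - 1) := by
  set c := (volume (phaseBall d 1)).toReal * (2 * d * R ^ (2 * d - 1)) with hc
  have hc0 : 0 ≤ c := by positivity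
  have hnn : ∀ z : Phase d, 0 ≤ phaseNorm z * spectrogram g g z := fun z =>
    mul_nonneg (phaseNorm_nonneg z) (spectrogram_nonneg _ _ z)
  have h1 : shiftDefect g R ≤ ENNReal.ofReal (c * ∫ z, phaseNorm z * spectrogram g g z) := by
    rw [← integral_const_mul, ofReal_integral_eq_lintegral_ofReal (hM.const_mul c)
      (ae_of_all _ fun z => mul_nonneg hc0 (hnn z))]
    refine lintegral_mono fun u => ?_
    rw [← ENNReal.ofReal_toReal (volume_phaseBall_diff_ne_top R u),
      ← ENNReal.ofReal_mul (spectrogram_nonneg _ _ u)]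
    refine ENNReal.ofReal_le_ofReal ?_
    refine (mul_le_mul_of_nonneg_left (measure_phaseBall_diff_le hd hR u)
      (spectrogram_nonneg _ _ u)).trans (le_of_eq ?_)
    rw [hc]; ring
  refine (ENNReal.toReal_mono ENNReal.ofReal_ne_top h1).trans (le_of_eq ?_)
  rw [ENNReal.toReal_ofReal (mul_nonneg hc0 (integral_nonneg hnn)), hc]
  ring

/-- A weighted mass of `|V_g g|²` that bounds `shiftDefect` from below. -/
noncomputable def truncatedMoment (g : L2 d) (r : ℝ) : ℝ :=
  ∫ u, spectrogram g g u * (phaseNorm u / (2 + phaseNorm u / r))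

theorem truncatedMoment_weight_nonneg {r : ℝ} (hr : 0 < r) (u : Phase d) :
    0 ≤ phaseNorm u / (2 + phaseNorm u / r) := by
  have := phaseNorm_nonneg u
  positivity

theorem integrable_truncatedMoment (g : L2 d) {r : ℝ} (hr : 0 < r) :
    Integrable fun u => spectrogram g g u * (phaseNorm u / (2 + phaseNorm u / r)) := by
  refine ((integrable_spectrogram g g).mul_const r).mono' ?_ (ae_of_all _ fun u => ?_)
  · refine (Continuous.mul (continuous_spectrogram g g) (continuous_phaseNorm.div
      (continuous_const.add (continuous_phaseNorm.div_const r)) fun u => ?_)).aestronglyMeasurable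
    have hu := phaseNorm_nonneg u
    have h : 0 < 2 + phaseNorm u / r := by positivity
    exact h.ne'
  · have hu := phaseNorm_nonneg u
    rw [Real.norm_of_nonneg (mul_nonneg (spectrogram_nonneg _ _ u)
      (truncatedMoment_weight_nonneg hr u))]
    refine mul_le_mul_of_nonneg_left ?_ (spectrogram_nonneg _ _ u)
    rw [div_le_iff₀ (by positivity)]
    field_simp
    linarith

/-- The weight vanishes only at the origin, a null set because `d ≥ 1`, while `|V_g g|²` has mass 1.
-/
theorem truncatedMoment_pos (hd : 1 ≤ d) {g : L2 d} (hg : ‖g‖ = 1) {r : ℝ} (hr : 0 < r) :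
    0 < truncatedMoment g r := by
  have hnn : ∀ u, 0 ≤ spectrogram g g u * (phaseNorm u / (2 + phaseNorm u / r)) := fun u =>
    mul_nonneg (spectrogram_nonneg _ _ u) (truncatedMoment_weight_nonneg hr u)
  refine (integral_nonneg hnn).lt_of_ne' fun h0 => ?_
  rw [integral_eq_zero_iff_of_nonneg hnn (integrable_truncatedMoment g hr)] at h0
  have hne : Nonempty (Fin d) := ⟨⟨0, hd⟩⟩
  have hae : ∀ᵐ u : Phase d, u ≠ 0 := by
    have hno : NullSingletonClass (volume : Measure (Phase d)) := by
      rw [Measure.volume_eq_prod]; infer_instance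
    rw [ae_iff]
    simp
  have hz : spectrogram g g =ᵐ[volume] 0 := by
    filter_upwards [h0, hae] with u hu hu0
    have hpos : 0 < phaseNorm u := (norm_pos_iff.mpr hu0).trans_le (norm_le_phaseNorm u)
    exact (mul_eq_zero.mp hu).resolve_right (by positivity)
  have h1 := integral_spectrogram g g
  rw [integral_congr_ae hz, hg] at h1
  simp at h1

theorem le_toReal_shiftDefect (hd : 1 ≤ d) {g : L2 d} {r R : ℝ} (hr : 0 < r) (hrR : r ≤ R)
    (htop : shiftDefect g R ≠ ⊤) :
    (volume (phaseBall d 1)).toReal * truncatedMoment g r * R ^ (2 * d - 1)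
      ≤ (shiftDefect g R).toReal := by
  have hR : 0 < R := hr.trans_le hrR
  set c := (volume (phaseBall d 1)).toReal * R ^ (2 * d - 1) with hc
  have hc0 : 0 ≤ c := by positivity
  have hRn : R ^ (2 * d) = R ^ (2 * d - 1) * R := by
    rw [← pow_succ, Nat.sub_add_cancel (by omega)]
  have hnn : ∀ u, 0 ≤ spectrogram g g u * (phaseNorm u / (2 + phaseNorm u / r)) := fun u =>
    mul_nonneg (spectrogram_nonneg _ _ u) (truncatedMoment_weight_nonneg hr u)
  have h1 : ENNReal.ofReal (c * truncatedMoment g r) ≤ shiftDefect g R := by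
    rw [truncatedMoment, ← integral_const_mul, ofReal_integral_eq_lintegral_ofReal
      ((integrable_truncatedMoment g hr).const_mul c)
      (ae_of_all _ fun u => mul_nonneg hc0 (hnn u))]
    refine lintegral_mono fun u => ?_
    rw [← ENNReal.ofReal_toReal (volume_phaseBall_diff_ne_top R u),
      ← ENNReal.ofReal_mul (spectrogram_nonneg _ _ u)]
    refine ENNReal.ofReal_le_ofReal ?_
    rw [mul_left_comm]
    refine mul_le_mul_of_nonneg_left (le_trans ?_ (measure_phaseBall_diff_ge hR u))
      (spectrogram_nonneg _ _ u)
    have hu := phaseNorm_nonneg u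
    rw [volume_phaseBall hR, hRn, hc]
    -- The right side is `|u| / (2 + |u| / R)`, increasing in `R`; its value at `r` is a bound
    -- uniform in `R ≥ r`.
    have h2 : phaseNorm u / (2 + phaseNorm u / r) ≤ R * (phaseNorm u / (2 * R + phaseNorm u)) := by
      have h3 : R * (phaseNorm u / (2 * R + phaseNorm u))
          = phaseNorm u / (2 + phaseNorm u / R) := by
        field_simp
      rw [h3]
      gcongr
    calc (volume (phaseBall d 1)).toReal * R ^ (2 * d - 1) *
          (phaseNorm u / (2 + phaseNorm u / r))
        ≤ (volume (phaseBall d 1)).toReal * R ^ (2 * d - 1) *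
          (R * (phaseNorm u / (2 * R + phaseNorm u))) := by gcongr
      _ = _ := by ring
  have h2 := ENNReal.toReal_mono htop h1
  have h3 : 0 ≤ truncatedMoment g r := integral_nonneg hnn
  rw [ENNReal.toReal_ofReal (mul_nonneg hc0 h3)] at h2
  refine le_trans (le_of_eq ?_) h2
  rw [hc]; ring

/-- For `R ≥ r` the trace of `H - H²` suffices. For `R < r` the ball has measure at most 1/2, so
rounding up to `A ≥ 1` alone costs 1/2, while `R ^ (2d-1) ≤ 1`. -/
theorem exists_lower_bound (hd : 1 ≤ d) {g : L2 d} (hg : ‖g‖ = 1) :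
    ∃ C : ℝ, 0 < C ∧ ∀ R : ℝ, 0 < R → ∀ (lam : ℕ → ℝ) (h : ℕ → L2 d),
      IsEigensystem g (phaseBall d R) lam h →
        C * R ^ (2 * d - 1) ≤ ∫ z, |spectrogramError g (phaseBall d R) h z| := by
  set v := (volume (phaseBall d 1)).toReal with hv
  have hv0 : 0 < v := volume_phaseBall_one_pos
  -- The 1 gives `R ^ (2d) ≤ R` for `R < r`, and `1 / (2v)` then gives `|B_R| ≤ 1/2`.
  set r := min 1 (1 / (2 * v)) with hr
  have hr0 : 0 < r := by positivity
  have hm := truncatedMoment_pos hd hg hr0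
  refine ⟨min (v * truncatedMoment g r) (1 / 2), by positivity, fun R hR lam h he => ?_⟩
  obtain ⟨htop, hlow, -, hceil⟩ := he.error_bounds hg (isCompact_phaseBall R) rfl
  rcases le_or_gt r R with hrR | hrR
  · refine le_trans ?_ ((le_toReal_shiftDefect hd hr0 hrR htop).trans hlow)
    gcongr
    exact min_le_left _ _
  · refine le_trans ?_ hceil
    have hR1 : R ≤ 1 := hrR.le.trans (min_le_left _ _)
    have hvol : (volume (phaseBall d R)).toReal ≤ 1 / 2 := by
      rw [volume_phaseBall hR]
      have h1 : R ^ (2 * d) ≤ R := pow_le_of_le_one hR.le hR1 (by omega)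
      have h2 : R ≤ 1 / (2 * v) := hrR.le.trans (min_le_right _ _)
      calc v * R ^ (2 * d) ≤ v * (1 / (2 * v)) := by gcongr; exact h1.trans h2
        _ = 1 / 2 := by field_simp
    have hvpos : 0 < (volume (phaseBall d R)).toReal := by
      rw [volume_phaseBall hR]; positivity
    have hc1 : (1 : ℝ) ≤ ⌈(volume (phaseBall d R)).toReal⌉₊ := by
      exact_mod_cast Nat.one_le_iff_ne_zero.mpr (Nat.ceil_pos.mpr hvpos).ne'
    have hp : R ^ (2 * d - 1) ≤ 1 := pow_le_one₀ hR.le hR1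
    have hp0 : 0 ≤ R ^ (2 * d - 1) := by positivity
    have hmin : min (v * truncatedMoment g r) (1 / 2) ≤ 1 / 2 := min_le_right _ _
    nlinarith [mul_le_mul_of_nonneg_right hmin hp0]

/-- The additive 1 in the error bound comes from rounding; it is absorbed by `(R / R₀) ^ (2d-1) ≥
1`, which makes the constant depend on `R₀`. -/
theorem exists_upper_bound (hd : 1 ≤ d) {g : L2 d} (hg : ‖g‖ = 1) (hM : MemMStar g) {R₀ : ℝ}
    (hR₀ : 0 < R₀) : ∃ C' : ℝ, 0 < C' ∧ ∀ R : ℝ, R₀ ≤ R →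
      ∀ (lam : ℕ → ℝ) (h : ℕ → L2 d), IsEigensystem g (phaseBall d R) lam h →
        ∫ z, |spectrogramError g (phaseBall d R) h z| ≤ C' * R ^ (2 * d - 1) := by
  set K := 2 * d * (volume (phaseBall d 1)).toReal * ∫ z, phaseNorm z * spectrogram g g z with hK
  have hK0 : 0 ≤ K := mul_nonneg (by positivity) (integral_nonneg fun z =>
    mul_nonneg (phaseNorm_nonneg z) (spectrogram_nonneg _ _ z))
  refine ⟨2 * K + (R₀ ^ (2 * d - 1))⁻¹, by positivity, fun R hR lam h he => ?_⟩
  have hRpos : 0 < R := hR₀.trans_le hR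
  obtain ⟨-, -, hup, -⟩ := he.error_bounds hg (isCompact_phaseBall R) rfl
  have h1 : (shiftDefect g R).toReal ≤ K * R ^ (2 * d - 1) := toReal_shiftDefect_le hd hM hRpos
  have h2 : 1 ≤ (R₀ ^ (2 * d - 1))⁻¹ * R ^ (2 * d - 1) := by
    rw [← div_eq_inv_mul, one_le_div (by positivity)]
    gcongr
  refine hup.trans ?_
  change 2 * (shiftDefect g R).toReal + 1 ≤ _
  linarith

end Main

theorem mainTheorem2 (d : ℕ) (hd : 1 ≤ d) (g : L2 d) (hg : ‖g‖ = 1) :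
    -- the eigenfunctions entering the accumulated spectrogram exist
    (∀ R : ℝ, 0 < R → ∃ (lam : ℕ → ℝ) (h : ℕ → L2 d), IsEigensystem g (phaseBall d R) lam h) ∧
    -- lower bound, for every choice of the eigenfunctions
    (∃ C : ℝ, 0 < C ∧ ∀ R : ℝ, 0 < R → ∀ (lam : ℕ → ℝ) (h : ℕ → L2 d),
      IsEigensystem g (phaseBall d R) lam h →
        Integrable (spectrogramError g (phaseBall d R) h) ∧
        C * R ^ (2 * d - 1) ≤ ∫ z, |spectrogramError g (phaseBall d R) h z|) ∧
    -- upper bound, for windows in `M^*` and radii bounded away from zero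
    (MemMStar g → ∀ R₀ : ℝ, 0 < R₀ → ∃ C' : ℝ, 0 < C' ∧ ∀ R : ℝ, R₀ ≤ R →
      ∀ (lam : ℕ → ℝ) (h : ℕ → L2 d), IsEigensystem g (phaseBall d R) lam h →
        ∫ z, |spectrogramError g (phaseBall d R) h z| ≤ C' * R ^ (2 * d - 1)) := by
  have hg0 : g ≠ 0 := by
    rintro rfl
    simp at hg
  refine ⟨fun R hR => exists_isEigensystem hd hg0 (isCompact_phaseBall R) (phaseBall_mem_nhds hR),
    ?_, fun hM R₀ hR₀ => exists_upper_bound hd hg hM hR₀⟩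
  obtain ⟨C, hC, hlow⟩ := exists_lower_bound hd hg
  exact ⟨C, hC, fun R hR lam h he =>
    ⟨integrable_spectrogramError (isCompact_phaseBall R), hlow R hR lam h he⟩⟩
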